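/- **Setting.** Let $d,T,B\ge 1$ be integers and let $\mathcal A\subset\mathbb R^d$ be a finite set. At each time $t=1,\dots,T$ an arm $A_t\in\mathcal A$ is pulled and the reward $Y_t=\langle A_t,\theta\rangle+\xi_t$ is generated, where $\theta\in\mathbb R^d$ is unknown and the noise terms $\xi_t$ are i.i.d. $N(0,\sigma^2)$. Time is split into $\lceil T/B\rceil$ consecutive batches of length $B$ (the last one possibly shorter). At the start of each batch the learner chooses, possibly with the help of internal randomness independent of the noise, all arms of the batch and a quantization function $\mathbb R^B\to\{0,1\}$, depending on past rewards only through the bits received after the previous batches; after the batch the learner receives only the one bit obtained by applying the quantization function to the rewards of that batch. The regret is $R_T=\sum_{t=1}^T\langle a^*-A_t,\theta\rangle$ with $a^*\in\arg\max_{a\in\mathcal A}\langle a,\theta\rangle$. **Corollary 2 (General Regret Lower Bound).** There is an absolute constant $p\ge 0$ such that for all $0<\sigma_0\le\sigma_1$ there are a constant $c>0$ and, for all $\alpha,\beta>0$, constants $c_1(\alpha)>0$ and $c_2(\beta)>0$, all depending on nothing else but $\sigma_0,\sigma_1$, with the following property. For all integers $d,T,B\ge1$, every $\sigma\in[\sigma_0,\sigma_1]$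 and every integer $K\ge d$ there is an action set $\mathcal A\subset\mathbb R^d$ with $|\mathcal A|=K$, $\max_{a\in\mathcal A}\|a\|_2\le 1$ and $\operatorname{span}\mathcal A=\mathbb R^d$ such that every algorithm of the above kind satisfies $$\sup_{\|\theta\|_2\le1}\mathbb E[R_T]\ \ge\ c\,\min\Big\{T,\ B\min\{d,\log K\}+\frac{\sqrt{dT\min\{d,\log K\}}}{(1+\log d)^p}\Big\}.$$ Moreover, for the same $\mathcal A$ and every such algorithm: for every $\alpha>0$ with $K\ge e^{\alpha d}$, $$\sup_{\|\theta\|_2\le1}\mathbb E[R_T]\ \ge\ c_1(\alpha)\min\Big\{T,\ dB+\frac{d\sqrt T}{(1+\log d)^p}\Big\},$$ and for every $\beta>0$ with $K\le e^{\beta d}$, $$\sup_{\|\theta\|_2\le1}\mathbb E[R_T]\ \ge\ c_2(\beta)\min\Big\{T,\ B\log K+\frac{\sqrt{dT\log K}}{(1+\log d)^p}\Big\}.$$ Since $N(0,\sigma^2)$ has mean $0$ and variance $\sigma^2$, the same bounds hold for the worst case over all noise laws with mean $0$ and second moment at most $\sigma^2$. -/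

import Mathlib

open MeasureTheory ProbabilityTheory

/-- An algorithm (learner and quantization rules) for the linear bandit with finite action set `A`,
batches of length `B`, and one bit of feedback per batch. `Ω` carries the learner's internal
randomness. A list `h` of `m` bits is the feedback received from the first `m` batches, newest bit
first, so its length also tells the learner which batch is about to start. Neither the arms nor the
quantization function of a batch can depend on past rewards except through these bits. -/
structure OneBitAlgorithm {d : ℕ} (A : Finset (EuclideanSpace ℝ (Fin d))) (B : ℕ)
    (Ω : Type*) [MeasurableSpace Ω] where
  /-- the `B` arms requested in the next batch -/
  arms : List Bool → Ω → Fin B → A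
  /-- the quantization function applied by the agent to the `B` rewards of the next batch -/
  quantizer : List Bool → Ω → (Fin B → ℝ) → Bool
  measurable_arms : ∀ h i, Measurable fun ω => arms h ω i
  measurable_quantizer : ∀ h,
    Measurable fun x : Ω × (Fin B → ℝ) => quantizer h x.1 x.2

namespace OneBitAlgorithm

noncomputable section

variable {d : ℕ} {A : Finset (EuclideanSpace ℝ (Fin d))} {B : ℕ} {Ω : Type*} [MeasurableSpace Ω]

/-- The bits received by the learner in the first `m` batches, newest first, when the parameter is
`θ`, the internal randomness is `ω` and the noise sequence is `ξ`. Times and batches are counted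
from `0`, so that batch `m` consists of the times `m * B + i` with `i < B`. -/
def bits (alg : OneBitAlgorithm A B Ω) (θ : EuclideanSpace ℝ (Fin d)) (ω : Ω) (ξ : ℕ → ℝ) :
    ℕ → List Bool
  | 0 => []
  | m + 1 =>
    let h := alg.bits θ ω ξ m
    alg.quantizer h ω
      (fun i => inner ℝ (alg.arms h ω i : EuclideanSpace ℝ (Fin d)) θ + ξ (m * B + i)) :: h

/-- The arm pulled at time `t` (in batch `t / B`, at position `t % B`). -/
def action (alg : OneBitAlgorithm A B Ω) (hB : 0 < B) (θ : EuclideanSpace ℝ (Fin d)) (ω : Ω)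
    (ξ : ℕ → ℝ) (t : ℕ) : EuclideanSpace ℝ (Fin d) :=
  alg.arms (alg.bits θ ω ξ (t / B)) ω ⟨t % B, Nat.mod_lt t hB⟩

/-- The cumulative regret over the times `0, …, T - 1`. The last batch may be shorter than `B`:
arms requested in it beyond the horizon are not counted, and its bit is never used. -/
def regret (alg : OneBitAlgorithm A B Ω) (hB : 0 < B) (T : ℕ) (θ : EuclideanSpace ℝ (Fin d))
    (ω : Ω) (ξ : ℕ → ℝ) : ℝ :=
  ∑ t ∈ Finset.range T,
    ((⨆ a : A, inner ℝ (a : EuclideanSpace ℝ (Fin d)) θ) - inner ℝ (alg.action hB θ ω ξ t) θ)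

/-- The expected cumulative regret when the internal randomness has law `P` and, independently of
it, the noise is i.i.d. with law `ν`. -/
def expectedRegret (alg : OneBitAlgorithm A B Ω) (hB : 0 < B) (T : ℕ) (P : Measure Ω)
    (ν : Measure ℝ) [IsProbabilityMeasure ν] (θ : EuclideanSpace ℝ (Fin d)) : ℝ :=
  ∫ x, alg.regret hB T θ x.1 x.2 ∂(P.prod (Measure.infinitePi fun _ : ℕ => ν))

/-- The worst expected regret over the parameters in the closed unit ball, with Gaussian noise of
mean `0` and variance `σ ^ 2`. -/
def worstCaseRegret (alg : OneBitAlgorithm A B Ω) (hB : 0 < B) (T : ℕ) (P : Measure Ω) (σ : ℝ) :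
    ℝ :=
  ⨆ θ : Metric.closedBall (0 : EuclideanSpace ℝ (Fin d)) 1,
    alg.expectedRegret hB T P (gaussianReal 0 (σ ^ 2).toNNReal) θ

end

end OneBitAlgorithm

/-!
The bound is the sum of a term `B min d (log K)`, caused by the scarcity of feedback, and a term
`√(d T min d (log K))`, caused by the noise. For each term there is an action set on which it is
unavoidable, and the action set may be chosen for the larger of the two terms
(`OneBitAlgorithm.exists_actionSet`). The bounds for `K ≥ exp (α d)` and `K ≤ exp (β d)` follow
because `min d (log K)` is then comparable with `d` or with `log K`
(`mul_min_le_min_of_mul_le`).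

*Feedback.* After `j` batches the learner has one of `2 ^ j` lists of bits. If the action set
contains unit vectors `θ s` such that no single action is well aligned with more than a fraction
`2 ^ (-J)` of them, then for at least half of the parameters `θ s` every arm available in the first
`J` batches is bad (`OneBitAlgorithm.min_le_worstCaseRegret_of_spread`). The standard basis, for
small `K`, or the vertices of a cube, by a Chernoff bound, give such families with `J` of the order
of `min d (log K)` (`exists_spread_actionSet`).

*Noise.* The coordinates are split into `m` groups of `n = ⌊d / m⌋`, and an action distributes a
weight `1 / √m` within each group, so that the learner plays `m` bandit problems with `n` options
at once but sees only one common reward. One option per problem is better by `Δ`. To find it in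
one problem while the others are already solved, `T` rounds do not suffice as long as `Δ ^ 2` is
below the order of `σ ^ 2 n / T`; hence the regret `T m Δ` of the order of
`√(m ^ 2 n T) = √(d m T)`
(`OneBitAlgorithm.mul_le_worstCaseRegret_of_problems`). Having `n ^ m` vertices among `K` actions
allows `m` of the order of `min d (log K) / log d`, which is where the logarithm is lost
(`exists_number_of_problems`).

The information argument is carried out on the finite tree of feedback bits: for a fixed value of
the internal randomness the feedback is a list of bits whose law is a product of the conditional
probabilities of the bits (`OneBitAlgorithm.measureReal_bits_eq`), its divergence is the sum of
the expected divergences of single bits (`kl_pathWeight_le`), and these are at most the divergences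
of the Gaussian rewards of one batch (`sum_bool_kl_gaussian_le`). A linear form of Pinsker's
inequality (`sum_mul_le_add_kl`) turns the divergence into a bound on the weight put on the good
options.
-/

/-! ### Gaussian vectors and one-bit observations -/

theorem gaussianReal_add_eq_withDensity (a δ : ℝ) {v : NNReal} (hv : v ≠ 0) :
    gaussianReal (a + δ) v = (gaussianReal a v).withDensity
      (fun y => ENNReal.ofReal (Real.exp ((δ * (y - a) - δ ^ 2 / 2) / v))) := by
  have hv' : (v : ℝ) ≠ 0 := by exact_mod_cast hv
  rw [gaussianReal_of_var_ne_zero _ hv, gaussianReal_of_var_ne_zero _ hv,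
    ← withDensity_mul _ (measurable_gaussianPDF _ _) (by fun_prop)]
  congr 1
  ext y
  rw [Pi.mul_apply, gaussianPDF, gaussianPDF, ← ENNReal.ofReal_mul (gaussianPDFReal_nonneg _ _ _),
    gaussianPDFReal, gaussianPDFReal, mul_assoc (Real.sqrt _)⁻¹, ← Real.exp_add]
  congr 3
  field_simp
  ring

/-- Change of measure for Gaussian vectors with independent coordinates of the same variance: the
likelihood ratio of a shift. -/
theorem pi_gaussianReal_add_eq_withDensity {ι : Type*} [Fintype ι] (a δ : ι → ℝ) {v : NNReal}
    (hv : v ≠ 0) :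
    Measure.pi (fun i => gaussianReal (a i + δ i) v) =
      (Measure.pi (fun i => gaussianReal (a i) v)).withDensity
        (fun y => ENNReal.ofReal (Real.exp (∑ i, (δ i * (y i - a i) - δ i ^ 2 / 2) / v))) := by
  refine Measure.pi_eq fun s hs => ?_
  set f : ι → ℝ → ENNReal := fun i y =>
    ENNReal.ofReal (Real.exp ((δ i * (y - a i) - δ i ^ 2 / 2) / v)) with hf
  have hfm : ∀ i, Measurable (f i) := fun i => by fun_prop
  have hind : iIndepFun (fun i (y : ι → ℝ) => (s i).indicator (f i) (y i))
      (Measure.pi fun i => gaussianReal (a i) v) :=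
    iIndepFun_pi (X := fun i => (s i).indicator (f i))
      fun i => ((hfm i).indicator (hs i)).aemeasurable
  rw [withDensity_apply _ (MeasurableSet.univ_pi hs), ← lintegral_indicator
    (MeasurableSet.univ_pi hs)]
  have key : ∀ y : ι → ℝ, (Set.univ.pi s).indicator (fun y : ι → ℝ =>
      ENNReal.ofReal (Real.exp (∑ i, (δ i * (y i - a i) - δ i ^ 2 / 2) / v))) y =
      ∏ i, (s i).indicator (f i) (y i) := by
    intro y
    by_cases hy : y ∈ Set.univ.pi s
    · rw [Set.indicator_of_mem hy, Real.exp_sum,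
        ENNReal.ofReal_prod_of_nonneg fun i _ => (Real.exp_pos _).le]
      exact Finset.prod_congr rfl fun i _ => by
        rw [Set.indicator_of_mem (hy i (Set.mem_univ i))]
    · rw [Set.indicator_of_notMem hy]
      simp only [Set.mem_pi, Set.mem_univ, true_implies, not_forall] at hy
      obtain ⟨i, hi⟩ := hy
      exact (Finset.prod_eq_zero (Finset.mem_univ i) (Set.indicator_of_notMem hi _)).symm
  simp_rw [key]
  rw [lintegral_prod_eq_prod_lintegral_of_indepFun Finset.univ _ hind
    fun i => ((hfm i).indicator (hs i)).comp (measurable_pi_apply i)]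
  refine Finset.prod_congr rfl fun i _ => ?_
  rw [gaussianReal_add_eq_withDensity _ _ hv, withDensity_apply _ (hs i),
    ← lintegral_indicator (hs i)]
  exact (measurePreserving_eval (fun i => gaussianReal (a i) v) i).lintegral_comp
    ((hfm i).indicator (hs i))

theorem pi_gaussianReal_absolutelyContinuous {ι : Type*} [Fintype ι] (a a' : ι → ℝ) {v : NNReal}
    (hv : v ≠ 0) :
    Measure.pi (fun i => gaussianReal (a i) v) ≪ Measure.pi (fun i => gaussianReal (a' i) v) := by
  have h := pi_gaussianReal_add_eq_withDensity a' (a - a') hv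
  simp only [Pi.sub_apply, add_sub_cancel] at h
  rw [h]
  exact withDensity_absolutelyContinuous _ _

/-- Data processing for one bit: observing only whether a Gaussian vector lies in `{q = b}` yields
at most the divergence of the Gaussian vectors themselves. The inequality comes from integrating
`log L ≤ log c + L / c - 1` over `{q = b}`, with `L` the likelihood ratio and `c` the ratio of the
two probabilities. -/
theorem sum_bool_kl_gaussian_le {ι : Type*} [Fintype ι] (a a' : ι → ℝ) {v : NNReal}
    (hv : v ≠ 0) {q : (ι → ℝ) → Bool} (hq : Measurable q) :
    ∑ b, (Measure.pi fun i => gaussianReal (a i) v).real {y | q y = b} *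
      (Real.log ((Measure.pi fun i => gaussianReal (a i) v).real {y | q y = b}) -
        Real.log ((Measure.pi fun i => gaussianReal (a' i) v).real {y | q y = b})) ≤
      ∑ i, (a' i - a i) ^ 2 / (2 * v) := by
  obtain ⟨δ, rfl⟩ : ∃ δ, a' = a + δ := ⟨a' - a, by simp⟩
  set γ := Measure.pi fun i => gaussianReal (a i) v with hγ
  set γ' := Measure.pi fun i => gaussianReal ((a + δ) i) v
  set l : (ι → ℝ) → ℝ := fun y => ∑ i, (δ i * (y i - a i) - δ i ^ 2 / 2) / v with hl
  have hdens : γ' = γ.withDensity fun y => ENNReal.ofReal (Real.exp (l y)) :=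
    pi_gaussianReal_add_eq_withDensity a δ hv
  have hid : ∀ i, Integrable (fun y : ι → ℝ => y i) γ := fun i =>
    integrable_comp_eval (X := fun _ => ℝ) (f := fun y : ℝ => y) (i := i)
      (memLp_one_iff_integrable.mp (memLp_id_gaussianReal 1))
  have hsum : ∀ i ∈ Finset.univ, Integrable
      (fun y : ι → ℝ => (δ i * (y i - a i) - δ i ^ 2 / 2) / v) γ := fun i _ =>
    ((((hid i).sub (integrable_const _)).const_mul _).sub (integrable_const _)).div_const _
  have hlint : Integrable l γ := integrable_finsetSum _ hsum
  have hmean : ∫ y, l y ∂γ = -∑ i, δ i ^ 2 / (2 * v) := by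
    rw [hl, integral_finsetSum _ hsum, ← Finset.sum_neg_distrib]
    refine Finset.sum_congr rfl fun i _ => ?_
    have h1 : ∫ y : ι → ℝ, y i ∂γ = a i := by
      rw [hγ, integral_comp_eval (X := fun _ => ℝ) (f := fun y : ℝ => y) (i := i) (by fun_prop),
        integral_id_gaussianReal]
    have h2 : Integrable (fun y : ι → ℝ => δ i * (y i - a i)) γ :=
      ((hid i).sub (integrable_const _)).const_mul _
    rw [integral_div, integral_sub h2 (integrable_const _), integral_const_mul,
      integral_sub (hid i) (integrable_const _), h1]
    simp
    field_simp
  have hexp : Integrable (fun y => Real.exp (l y)) γ := by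
    have hm : Measurable fun y => Real.exp (l y) := by fun_prop
    refine ⟨hm.aestronglyMeasurable, ?_⟩
    rw [hasFiniteIntegral_iff_ofReal (Filter.Eventually.of_forall fun y => (Real.exp_pos _).le)]
    have : γ' Set.univ = 1 := measure_univ
    rw [hdens, withDensity_apply _ MeasurableSet.univ, Measure.restrict_univ] at this
    rw [this]
    exact ENNReal.one_lt_top
  have hE : ∀ b, MeasurableSet {y | q y = b} := fun b => hq (measurableSet_singleton b)
  have hreal : ∀ b, γ'.real {y | q y = b} = ∫ y in {y | q y = b}, Real.exp (l y) ∂γ := by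
    intro b
    rw [measureReal_def, hdens, withDensity_apply _ (hE b),
      integral_eq_lintegral_of_nonneg_ae
        (Filter.Eventually.of_forall fun y => (Real.exp_pos _).le)
        hexp.aestronglyMeasurable.restrict]
  have hterm : ∀ b, γ.real {y | q y = b} * (Real.log (γ.real {y | q y = b}) -
      Real.log (γ'.real {y | q y = b})) ≤ -∫ y in {y | q y = b}, l y ∂γ := by
    intro b
    set E := {y | q y = b}
    by_cases h0 : γ E = 0
    · have h1 : γ.real E = 0 := by simp [measureReal_def, h0]
      rw [h1, Measure.restrict_eq_zero.mpr h0]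
      simp
    have hpos : 0 < γ.real E := by
      rw [measureReal_def]; exact ENNReal.toReal_pos h0 (measure_ne_top _ _)
    have hpos' : 0 < γ'.real E := by
      rw [measureReal_def]
      refine ENNReal.toReal_pos (fun h => h0 ?_) (measure_ne_top _ _)
      exact pi_gaussianReal_absolutelyContinuous a (a + δ) hv h
    set c := γ'.real E / γ.real E with hc
    have hcpos : 0 < c := div_pos hpos' hpos
    have hle : ∫ y in E, l y ∂γ ≤ ∫ y in E, (Real.exp (l y) / c + (Real.log c - 1)) ∂γ := by
      refine setIntegral_mono hlint.integrableOn
        ((hexp.div_const c).add (integrable_const _)).integrableOn fun y => ?_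
      have := Real.log_le_sub_one_of_pos (div_pos (Real.exp_pos (l y)) hcpos)
      rw [Real.log_div (Real.exp_pos _).ne' hcpos.ne', Real.log_exp] at this
      simp only
      linarith
    rw [integral_add (hexp.div_const c).integrableOn (integrable_const _).integrableOn,
      integral_div, ← hreal, setIntegral_const, smul_eq_mul, hc,
      Real.log_div hpos'.ne' hpos.ne'] at hle
    have : γ'.real E / (γ'.real E / γ.real E) = γ.real E := by field_simp
    rw [this] at hle
    linarith
  calc _ ≤ ∑ b, -∫ y in {y | q y = b}, l y ∂γ := Finset.sum_le_sum fun b _ => hterm b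
    _ = -∫ y, l y ∂γ := by
      rw [Finset.sum_neg_distrib, Fintype.sum_bool]
      have hcompl : {y | q y = false} = {y | q y = true}ᶜ := by ext y; simp
      rw [hcompl, integral_add_compl (hE true) hlint]
    _ = _ := by rw [hmean]; simp

/-! ### Laws on lists of bits -/

/-- The lists of `m` bits. -/
def bitLists : ℕ → Finset (List Bool)
  | 0 => {[]}
  | m + 1 => ((Finset.univ : Finset Bool) ×ˢ bitLists m).map
      ⟨fun x => x.1 :: x.2, fun x y h => by
        simp only [List.cons.injEq] at h; exact Prod.ext h.1 h.2⟩

/-- The probability of a list of bits, newest first, when `k h b` is the probability that the next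
bit is `b` after the bits `h`. -/
def pathWeight (k : List Bool → Bool → ℝ) : List Bool → ℝ
  | [] => 1
  | b :: h => pathWeight k h * k h b

theorem sum_bitLists_succ (m : ℕ) (F : List Bool → ℝ) :
    ∑ h ∈ bitLists (m + 1), F h = ∑ h ∈ bitLists m, ∑ b, F (b :: h) := by
  rw [bitLists, Finset.sum_map, Finset.sum_product, Finset.sum_comm]
  rfl

theorem card_bitLists (m : ℕ) : (bitLists m).card = 2 ^ m := by
  induction m with
  | zero => rfl
  | succ m ih => rw [bitLists, Finset.card_map, Finset.card_product, ih, pow_succ']; rfl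

theorem cons_mem_bitLists {m : ℕ} {h : List Bool} (hh : h ∈ bitLists m) (b : Bool) :
    b :: h ∈ bitLists (m + 1) :=
  Finset.mem_map.mpr ⟨(b, h), by simp [hh], rfl⟩

section pathWeight

variable {k k' : List Bool → Bool → ℝ}

theorem pathWeight_nonneg (hk : ∀ h b, 0 ≤ k h b) (h : List Bool) : 0 ≤ pathWeight k h := by
  induction h with
  | nil => exact zero_le_one
  | cons b h ih => exact mul_nonneg ih (hk h b)

theorem sum_pathWeight (hk : ∀ h, ∑ b, k h b = 1) (m : ℕ) :
    ∑ h ∈ bitLists m, pathWeight k h = 1 := by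
  induction m with
  | zero => simp [bitLists, pathWeight]
  | succ m ih => simp_rw [sum_bitLists_succ, pathWeight, ← Finset.mul_sum, hk, mul_one, ih]

theorem pathWeight_eq_zero_of (hac : ∀ h b, k' h b = 0 → k h b = 0) (h : List Bool)
    (hh : pathWeight k' h = 0) : pathWeight k h = 0 := by
  induction h with
  | nil => exact hh
  | cons b h ih =>
    rcases mul_eq_zero.mp hh with h0 | h0
    · simp [pathWeight, ih h0]
    · simp [pathWeight, hac h b h0]

/-- Chain rule: the divergence of two laws on lists of bits is the sum of the expected divergences
of the individual bits. -/
theorem kl_pathWeight_le (hk : ∀ h b, 0 ≤ k h b) (hk1 : ∀ h, ∑ b, k h b = 1)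
    (hac : ∀ h b, k' h b = 0 → k h b = 0) {D : List Bool → ℝ}
    (hD : ∀ h, ∑ b, k h b * (Real.log (k h b) - Real.log (k' h b)) ≤ D h) (m : ℕ) :
    ∑ h ∈ bitLists m, pathWeight k h * (Real.log (pathWeight k h) - Real.log (pathWeight k' h)) ≤
      ∑ j ∈ Finset.range m, ∑ h ∈ bitLists j, pathWeight k h * D h := by
  induction m with
  | zero => simp [bitLists, pathWeight]
  | succ m ih =>
    rw [Finset.sum_range_succ, sum_bitLists_succ]
    have hsplit : ∀ h b, pathWeight k (b :: h) *
        (Real.log (pathWeight k (b :: h)) - Real.log (pathWeight k' (b :: h))) =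
        pathWeight k h * (Real.log (pathWeight k h) - Real.log (pathWeight k' h)) * k h b +
        pathWeight k h * (k h b * (Real.log (k h b) - Real.log (k' h b))) := by
      intro h b
      simp only [pathWeight]
      by_cases h0 : pathWeight k h = 0
      · simp [h0]
      by_cases h1 : k h b = 0
      · simp [h1]
      rw [Real.log_mul h0 h1, Real.log_mul (fun h' => h0 (pathWeight_eq_zero_of hac h h'))
        (fun h' => h1 (hac h b h'))]
      ring
    simp_rw [hsplit, Finset.sum_add_distrib, ← Finset.mul_sum, hk1, mul_one]
    exact add_le_add ih (Finset.sum_le_sum fun h _ =>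
      mul_le_mul_of_nonneg_left (hD h) (pathWeight_nonneg hk h))

end pathWeight

/-- A linearised Pinsker inequality: changing the measure from `a` to `b` raises the mean of a
`[0, 1]`-valued function by at most `1 / 8` plus twice the divergence. Pointwise, it compares
`(√b - √a) ^ 2` with the divergence. -/
theorem sum_mul_le_add_kl {α : Type*} (s : Finset α) {a b u : α → ℝ}
    (ha : ∀ x ∈ s, 0 ≤ a x) (hb : ∀ x ∈ s, 0 ≤ b x) (hab : ∀ x ∈ s, b x = 0 → a x = 0)
    (ha1 : ∑ x ∈ s, a x = 1) (hb1 : ∑ x ∈ s, b x = 1) (hu : ∀ x ∈ s, u x ∈ Set.Icc (0 : ℝ) 1) :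
    ∑ x ∈ s, b x * u x ≤ ∑ x ∈ s, a x * u x + 1 / 8 +
      2 * ∑ x ∈ s, a x * (Real.log (a x) - Real.log (b x)) := by
  have key : ∀ x ∈ s, (b x - a x) * (u x - 1 / 2) ≤
      2 * (a x * (Real.log (a x) - Real.log (b x)) + b x - a x) + (a x + b x) / 16 := by
    intro x hx
    obtain ⟨hu0, hu1⟩ := hu x hx
    have hsq : (√(b x) - √(a x)) ^ 2 ≤
        a x * (Real.log (a x) - Real.log (b x)) + b x - a x := by
      rcases (ha x hx).eq_or_lt with h0 | h0
      · simp [← h0, Real.sq_sqrt (hb x hx)]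
      have h1 : 0 < b x := (hb x hx).lt_of_ne fun h => h0.ne' (hab x hx h.symm)
      have hsa := Real.sqrt_pos.mpr h0
      have hsb := Real.sqrt_pos.mpr h1
      have hl := Real.log_le_sub_one_of_pos (div_pos hsb hsa)
      rw [Real.log_div hsb.ne' hsa.ne', Real.log_sqrt h0.le, Real.log_sqrt h1.le] at hl
      have h2 : a x * (√(b x) / √(a x)) = √(a x) * √(b x) := by
        nth_rewrite 1 [← Real.mul_self_sqrt h0.le]
        field_simp
      have h3 := mul_le_mul_of_nonneg_left hl h0.le
      have h4 := Real.sq_sqrt h0.le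
      have h5 := Real.sq_sqrt h1.le
      nlinarith
    have hfac : b x - a x = (√(b x) - √(a x)) * (√(b x) + √(a x)) := by
      have h4 := Real.sq_sqrt (ha x hx)
      have h5 := Real.sq_sqrt (hb x hx)
      linarith
    have habs : (b x - a x) * (u x - 1 / 2) ≤ |b x - a x| / 2 := by
      rcases abs_cases (b x - a x) with ⟨h, _⟩ | ⟨h, _⟩ <;> rw [h] <;> nlinarith
    have hamgm : |b x - a x| / 2 ≤ 2 * (√(b x) - √(a x)) ^ 2 + (√(b x) + √(a x)) ^ 2 / 32 := by
      rw [hfac, abs_mul, abs_of_nonneg (add_nonneg (Real.sqrt_nonneg (b x)) (Real.sqrt_nonneg _)),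
        ← sq_abs (√(b x) - √(a x))]
      nlinarith [sq_nonneg (|√(b x) - √(a x)| * 8 - (√(b x) + √(a x)))]
    have hplus : (√(b x) + √(a x)) ^ 2 ≤ 2 * (a x + b x) := by
      have h4 := Real.sq_sqrt (ha x hx)
      have h5 := Real.sq_sqrt (hb x hx)
      nlinarith [sq_nonneg (√(b x) - √(a x))]
    linarith
  have hsum := Finset.sum_le_sum key
  simp only [sub_mul, mul_sub, Finset.sum_sub_distrib, Finset.sum_add_distrib, ← Finset.mul_sum,
    ← Finset.sum_mul, ← Finset.sum_div, ha1, hb1] at hsum ⊢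
  linarith

/-! ### The law of the feedback -/

/-- The probability that the quantizer `q h` returns the bit `b` when the rewards of the batch
following the bits `h` are independent Gaussian variables with means `μ h` and variance `v`. -/
noncomputable def bitProb {B : ℕ} (v : NNReal) (q : List Bool → (Fin B → ℝ) → Bool)
    (μ : List Bool → Fin B → ℝ) (h : List Bool) (b : Bool) : ℝ :=
  (Measure.pi fun i => gaussianReal (μ h i) v).real {y | q h y = b}

section bitProb

variable {B : ℕ} {v : NNReal} {q : List Bool → (Fin B → ℝ) → Bool}
  {μ μ' : List Bool → Fin B → ℝ}

theorem bitProb_nonneg (h : List Bool) (b : Bool) : 0 ≤ bitProb v q μ h b := measureReal_nonneg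

theorem sum_bitProb (hq : ∀ h, Measurable (q h)) (h : List Bool) :
    ∑ b, bitProb v q μ h b = 1 := by
  have hcompl : {y | q h y = false} = {y | q h y = true}ᶜ := by ext y; simp
  have hE : MeasurableSet {y | q h y = true} := hq h (measurableSet_singleton true)
  rw [Fintype.sum_bool, bitProb, bitProb, hcompl, probReal_compl_eq_one_sub hE]
  ring

theorem bitProb_eq_zero_of (hv : v ≠ 0) (h : List Bool) (b : Bool)
    (hb : bitProb v q μ' h b = 0) : bitProb v q μ h b = 0 := by
  rw [bitProb, measureReal_eq_zero_iff] at hb ⊢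
  exact pi_gaussianReal_absolutelyContinuous _ _ hv hb

/-- Comparison of two models for the rewards: the means `μ'` cannot raise the expectation of a
`[0, 1]`-valued function of the feedback by more than `1 / 8` plus the total squared change of the
means, measured in the model with means `μ`. -/
theorem sum_pathWeight_bitProb_le (hv : v ≠ 0) (hq : ∀ h, Measurable (q h)) {u : List Bool → ℝ}
    (hu : ∀ h, u h ∈ Set.Icc (0 : ℝ) 1) (m : ℕ) :
    ∑ h ∈ bitLists m, pathWeight (bitProb v q μ') h * u h ≤
      ∑ h ∈ bitLists m, pathWeight (bitProb v q μ) h * u h + 1 / 8 +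
        2 * ∑ j ∈ Finset.range m, ∑ h ∈ bitLists j, pathWeight (bitProb v q μ) h *
          ∑ i, (μ' h i - μ h i) ^ 2 / (2 * v) := by
  have hac : ∀ h b, bitProb v q μ' h b = 0 → bitProb v q μ h b = 0 := bitProb_eq_zero_of hv
  refine (sum_mul_le_add_kl (bitLists m) (fun h _ => pathWeight_nonneg bitProb_nonneg h)
    (fun h _ => pathWeight_nonneg bitProb_nonneg h) (fun h _ => pathWeight_eq_zero_of hac h)
    (sum_pathWeight (sum_bitProb hq) m) (sum_pathWeight (sum_bitProb hq) m)
    fun h _ => hu h).trans ?_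
  gcongr
  exact kl_pathWeight_le bitProb_nonneg (sum_bitProb hq) hac
    (fun h => sum_bool_kl_gaussian_le _ _ hv (hq h)) m

end bitProb

namespace OneBitAlgorithm

variable {d : ℕ} {A : Finset (EuclideanSpace ℝ (Fin d))} {B : ℕ} {Ω : Type*} [MeasurableSpace Ω]
  (alg : OneBitAlgorithm A B Ω) (θ : EuclideanSpace ℝ (Fin d))

theorem bits_mem_bitLists (ω : Ω) (ξ : ℕ → ℝ) (m : ℕ) : alg.bits θ ω ξ m ∈ bitLists m := by
  induction m with
  | zero => simp [bits, bitLists]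
  | succ m ih => exact cons_mem_bitLists ih _

theorem bits_congr (ω : Ω) {ξ ξ' : ℕ → ℝ} (m : ℕ) (h : ∀ t < m * B, ξ t = ξ' t) :
    alg.bits θ ω ξ m = alg.bits θ ω ξ' m := by
  induction m with
  | zero => rfl
  | succ m ih =>
    have hm := ih fun t ht => h t (ht.trans_le (Nat.mul_le_mul_right B m.le_succ))
    have hB : ∀ i : Fin B, ξ (m * B + i) = ξ' (m * B + i) := fun i =>
      h _ (by rw [Nat.succ_mul]; omega)
    simp only [bits, hm, hB]

theorem measurable_inner_arms (h : List Bool) (i : Fin B) :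
    Measurable fun ω => inner ℝ (alg.arms h ω i : EuclideanSpace ℝ (Fin d)) θ := by
  have := (measurable_subtype_coe.comp (alg.measurable_arms h i)).inner_const (𝕜 := ℝ) (c := θ)
  exact this

theorem bits_succ_eq_cons_iff (ω : Ω) (ξ : ℕ → ℝ) (m : ℕ) (b : Bool) (h : List Bool) :
    alg.bits θ ω ξ (m + 1) = b :: h ↔ alg.bits θ ω ξ m = h ∧ alg.quantizer h ω
      (fun i => inner ℝ (alg.arms h ω i : EuclideanSpace ℝ (Fin d)) θ + ξ (m * B + i)) = b := by
  simp only [bits, List.cons.injEq]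
  constructor
  · rintro ⟨h1, rfl⟩
    exact ⟨rfl, h1⟩
  · rintro ⟨rfl, h1⟩
    exact ⟨h1, rfl⟩

theorem measurableSet_bits_eq (m : ℕ) (h : List Bool) :
    MeasurableSet {x : Ω × (ℕ → ℝ) | alg.bits θ x.1 x.2 m = h} := by
  induction m generalizing h with
  | zero => simp [bits]
  | succ m ih =>
    cases h with
    | nil => simp [bits]
    | cons b h =>
      simp_rw [bits_succ_eq_cons_iff]
      refine (ih h).inter ?_
      have hm : Measurable fun x : Ω × (ℕ → ℝ) => alg.quantizer h x.1 (fun i =>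
          inner ℝ (alg.arms h x.1 i : EuclideanSpace ℝ (Fin d)) θ + x.2 (m * B + i)) := by
        refine (alg.measurable_quantizer h).comp (measurable_fst.prodMk
          (measurable_pi_lambda _ fun i => ?_))
        exact ((alg.measurable_inner_arms θ h i).comp measurable_fst).add
          ((measurable_pi_apply _).comp measurable_snd)
      exact hm (measurableSet_singleton b)

theorem measurable_comp_bits (m : ℕ) {G : List Bool → Ω → ℝ} (hG : ∀ h, Measurable (G h)) :
    Measurable fun x : Ω × (ℕ → ℝ) => G (alg.bits θ x.1 x.2 m) x.1 := by
  have heq : (fun x : Ω × (ℕ → ℝ) => G (alg.bits θ x.1 x.2 m) x.1) = fun x =>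
      ∑ h ∈ bitLists m, {x : Ω × (ℕ → ℝ) | alg.bits θ x.1 x.2 m = h}.indicator
        (fun x => G h x.1) x := by
    ext x
    rw [Finset.sum_eq_single_of_mem (alg.bits θ x.1 x.2 m) (alg.bits_mem_bitLists θ x.1 x.2 m)]
    · simp [Set.indicator]
    · intro h _ hne
      simp [Set.indicator, hne.symm]
  rw [heq]
  exact Finset.measurable_sum _ fun h _ =>
    ((hG h).comp measurable_fst).indicator (alg.measurableSet_bits_eq θ m h)

/-- The law of the feedback in the first `m` batches, for a fixed value of the internal
randomness. -/
theorem measureReal_bits_eq (v : NNReal) (ω : Ω) (m : ℕ) (h : List Bool) (hh : h ∈ bitLists m) :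
    (Measure.infinitePi fun _ : ℕ => gaussianReal 0 v).real {ξ | alg.bits θ ω ξ m = h} =
      pathWeight (bitProb v (fun h => alg.quantizer h ω) fun h i =>
        inner ℝ (alg.arms h ω i : EuclideanSpace ℝ (Fin d)) θ) h := by
  classical
  set N := Measure.infinitePi fun _ : ℕ => gaussianReal 0 v with hN
  induction m generalizing h with
  | zero =>
    simp only [bitLists, Finset.mem_singleton] at hh
    subst hh
    simp [bits, pathWeight]
  | succ m ih =>
    obtain ⟨⟨b, h'⟩, hmem, rfl⟩ := Finset.mem_map.mp hh
    have hh' : h' ∈ bitLists m := (Finset.mem_product.mp hmem).2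
    change N.real {ξ | alg.bits θ ω ξ (m + 1) = b :: h'} = _ * _
    rw [← ih h' hh']
    simp_rw [bits_succ_eq_cons_iff]
    set S := Finset.range (m * B)
    set S' := Finset.Ico (m * B) (m * B + B)
    have hdisj : Disjoint S S' := by
      rw [Finset.disjoint_left]
      intro t ht ht'
      simp only [S, S', Finset.mem_range, Finset.mem_Ico] at ht ht'
      omega
    have hiid : iIndepFun (fun (t : ℕ) (ξ : ℕ → ℝ) => ξ t) N :=
      iIndepFun_infinitePi (X := fun (_ : ℕ) (x : ℝ) => x) fun _ => measurable_id
    have hind := hiid.indepFun_finset S S' hdisj fun t => measurable_pi_apply t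
    have hq : Measurable (alg.quantizer h' ω) :=
      (alg.measurable_quantizer h').comp measurable_prodMk_left
    set a : Fin B → ℝ := fun i => inner ℝ (alg.arms h' ω i : EuclideanSpace ℝ (Fin d)) θ
    -- Both events are functions of the noise in disjoint time windows.
    set ext : (S → ℝ) → ℕ → ℝ := fun z t => if ht : t ∈ S then z ⟨t, ht⟩ else 0 with hext
    have hextm : Measurable ext := by
      refine measurable_pi_lambda _ fun t => ?_
      by_cases ht : t ∈ S
      · simpa [hext, ht] using measurable_pi_apply _
      · simp [hext, ht]
    set E₁ : Set (S → ℝ) := {z | alg.bits θ ω (ext z) m = h'}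
    have hE₁ : MeasurableSet E₁ :=
      ((measurable_const (a := ω)).prodMk hextm) (alg.measurableSet_bits_eq θ m h')
    set E₂ : Set (S' → ℝ) := {z | alg.quantizer h' ω (fun i => a i + z ⟨m * B + i, by
      simp [S']⟩) = b}
    have hE₂ : MeasurableSet E₂ := by
      have : Measurable fun z : S' → ℝ => alg.quantizer h' ω (fun i => a i + z ⟨m * B + i, by
          simp [S']⟩) :=
        hq.comp (measurable_pi_lambda _ fun i => (measurable_pi_apply _).const_add _)
      exact this (measurableSet_singleton b)
    have h1 : {ξ : ℕ → ℝ | alg.bits θ ω ξ m = h'} = (fun ξ (t : S) => ξ t) ⁻¹' E₁ := by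
      ext ξ
      simp only [Set.mem_ofPred_eq, Set.mem_preimage, E₁]
      rw [alg.bits_congr θ ω (ξ := ξ) (ξ' := ext fun t : S => ξ t) m fun t ht => by
        have : t ∈ S := Finset.mem_range.mpr ht
        simp [hext, this]]
    have h2 : {ξ : ℕ → ℝ | alg.quantizer h' ω (fun i => a i + ξ (m * B + i)) = b} =
        (fun ξ (t : S') => ξ t) ⁻¹' E₂ := rfl
    have hlaw : N.map (fun ξ (i : Fin B) => a i + ξ (m * B + i)) =
        Measure.pi fun i => gaussianReal (a i) v := by
      have hinj : Function.Injective fun i : Fin B => m * B + (i : ℕ) := fun i j hij =>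
        Fin.ext (Nat.add_left_cancel hij)
      have hw := ((hiid.precomp hinj).comp (fun i x => a i + x) fun i =>
        measurable_const_add (a i))
      rw [iIndepFun_iff_map_fun_eq_pi_map fun i => ((measurable_const_add (a i)).comp
        (measurable_pi_apply _)).aemeasurable] at hw
      refine hw.trans ?_
      congr 1
      ext1 i
      rw [← Measure.map_map (measurable_const_add (a i)) (measurable_pi_apply _), hN,
        Measure.infinitePi_map_eval, gaussianReal_map_const_add, zero_add]
    have h3 : bitProb v (fun h => alg.quantizer h ω) (fun h i =>
        inner ℝ (alg.arms h ω i : EuclideanSpace ℝ (Fin d)) θ) h' b =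
        N.real {ξ : ℕ → ℝ | alg.quantizer h' ω (fun i => a i + ξ (m * B + i)) = b} := by
      have hE : MeasurableSet {y | alg.quantizer h' ω y = b} := hq (measurableSet_singleton b)
      rw [bitProb, ← hlaw, map_measureReal_apply (by fun_prop) hE]
      rfl
    rw [h3, Set.ofPred_and, h2, h1, measureReal_def,
      hind.measure_inter_preimage_eq_mul _ _ hE₁ hE₂, ENNReal.toReal_mul]
    rfl

theorem integral_comp_bits (v : NNReal) (ω : Ω) (m : ℕ) (F : List Bool → ℝ) :
    ∫ ξ, F (alg.bits θ ω ξ m) ∂(Measure.infinitePi fun _ : ℕ => gaussianReal 0 v) =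
      ∑ h ∈ bitLists m, pathWeight (bitProb v (fun h => alg.quantizer h ω) fun h i =>
        inner ℝ (alg.arms h ω i : EuclideanSpace ℝ (Fin d)) θ) h * F h := by
  have hmeas : ∀ h, MeasurableSet {ξ | alg.bits θ ω ξ m = h} := fun h =>
    measurable_prodMk_left (alg.measurableSet_bits_eq θ m h)
  have heq : (fun ξ => F (alg.bits θ ω ξ m)) = fun ξ =>
      ∑ h ∈ bitLists m, {ξ | alg.bits θ ω ξ m = h}.indicator (fun _ => F h) ξ := by
    ext ξ
    rw [Finset.sum_eq_single_of_mem _ (alg.bits_mem_bitLists θ ω ξ m)]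
    · simp [Set.indicator]
    · intro h _ hne
      exact Set.indicator_of_notMem (fun hx => hne (Eq.symm hx)) _
  rw [heq, integral_finsetSum _ fun h _ => (integrable_const _).indicator (hmeas h)]
  refine Finset.sum_congr rfl fun h hh => ?_
  rw [integral_indicator_const _ (hmeas h), alg.measureReal_bits_eq θ v ω m h hh, smul_eq_mul]

end OneBitAlgorithm

/-! ### Worst-case regret and scarcity of feedback -/

namespace OneBitAlgorithm

variable {d : ℕ} {A : Finset (EuclideanSpace ℝ (Fin d))} {B : ℕ} {Ω : Type*} [MeasurableSpace Ω]
  (alg : OneBitAlgorithm A B Ω) (hB : 0 < B) (T : ℕ)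

theorem action_mem (θ : EuclideanSpace ℝ (Fin d)) (ω : Ω) (ξ : ℕ → ℝ) (t : ℕ) :
    alg.action hB θ ω ξ t ∈ A :=
  Subtype.prop _

theorem inner_le_iSup (θ : EuclideanSpace ℝ (Fin d)) {a : EuclideanSpace ℝ (Fin d)} (ha : a ∈ A) :
    inner ℝ a θ ≤ ⨆ a : A, inner ℝ (a : EuclideanSpace ℝ (Fin d)) θ :=
  le_ciSup (f := fun a : A => inner ℝ (a : EuclideanSpace ℝ (Fin d)) θ)
    (Set.finite_range _).bddAbove ⟨a, ha⟩

theorem regret_nonneg (θ : EuclideanSpace ℝ (Fin d)) (ω : Ω) (ξ : ℕ → ℝ) :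
    0 ≤ alg.regret hB T θ ω ξ :=
  Finset.sum_nonneg fun t _ => sub_nonneg.mpr (inner_le_iSup θ (alg.action_mem hB θ ω ξ t))

theorem regret_le (hA : ∀ a ∈ A, ‖a‖ ≤ 1) {θ : EuclideanSpace ℝ (Fin d)} (hθ : ‖θ‖ ≤ 1) (ω : Ω)
    (ξ : ℕ → ℝ) : alg.regret hB T θ ω ξ ≤ 2 * T := by
  have hinner : ∀ a ∈ A, |inner ℝ a θ| ≤ 1 := fun a ha =>
    (abs_real_inner_le_norm a θ).trans (mul_le_one₀ (hA a ha) (norm_nonneg θ) hθ)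
  have hne : Nonempty A := ⟨⟨_, alg.action_mem hB θ ω ξ 0⟩⟩
  have hsup : ⨆ a : A, inner ℝ (a : EuclideanSpace ℝ (Fin d)) θ ≤ 1 :=
    ciSup_le fun a => (abs_le.mp (hinner a a.2)).2
  calc alg.regret hB T θ ω ξ ≤ ∑ _t ∈ Finset.range T, (2 : ℝ) :=
        Finset.sum_le_sum fun t _ => by
          have := (abs_le.mp (hinner _ (alg.action_mem hB θ ω ξ t))).1
          linarith
    _ = 2 * T := by simp [mul_comm]

theorem measurable_regret (θ : EuclideanSpace ℝ (Fin d)) :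
    Measurable fun x : Ω × (ℕ → ℝ) => alg.regret hB T θ x.1 x.2 :=
  Finset.measurable_sum _ fun t _ => (alg.measurable_comp_bits θ (t / B)
    (G := fun h ω => inner ℝ (alg.arms h ω ⟨t % B, Nat.mod_lt t hB⟩ :
      EuclideanSpace ℝ (Fin d)) θ) fun h => alg.measurable_inner_arms θ h _).const_sub _

theorem integrable_regret (hA : ∀ a ∈ A, ‖a‖ ≤ 1) {θ : EuclideanSpace ℝ (Fin d)} (hθ : ‖θ‖ ≤ 1)
    (M : Measure (Ω × (ℕ → ℝ))) [IsFiniteMeasure M] :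
    Integrable (fun x : Ω × (ℕ → ℝ) => alg.regret hB T θ x.1 x.2) M :=
  Integrable.of_bound (alg.measurable_regret hB T θ).aestronglyMeasurable (2 * T)
    (Filter.Eventually.of_forall fun x => by
      rw [Real.norm_of_nonneg (alg.regret_nonneg hB T θ x.1 x.2)]
      exact alg.regret_le hB T hA hθ x.1 x.2)

variable (P : Measure Ω) [IsProbabilityMeasure P] (σ : ℝ)

theorem expectedRegret_le_worstCaseRegret (hA : ∀ a ∈ A, ‖a‖ ≤ 1)
    {θ : EuclideanSpace ℝ (Fin d)} (hθ : ‖θ‖ ≤ 1) :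
    alg.expectedRegret hB T P (gaussianReal 0 (σ ^ 2).toNNReal) θ ≤
      alg.worstCaseRegret hB T P σ := by
  refine le_ciSup (f := fun θ : Metric.closedBall (0 : EuclideanSpace ℝ (Fin d)) 1 =>
    alg.expectedRegret hB T P (gaussianReal 0 (σ ^ 2).toNNReal) θ) ⟨2 * T, ?_⟩
    ⟨θ, mem_closedBall_zero_iff.mpr hθ⟩
  rintro _ ⟨θ', rfl⟩
  have hθ' : ‖(θ' : EuclideanSpace ℝ (Fin d))‖ ≤ 1 := mem_closedBall_zero_iff.mp θ'.2
  refine (integral_mono (alg.integrable_regret hB T hA hθ' _) (integrable_const (2 * T : ℝ))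
    fun x => alg.regret_le hB T hA hθ' x.1 x.2).trans ?_
  simp

theorem worstCaseRegret_nonneg (hA : ∀ a ∈ A, ‖a‖ ≤ 1) : 0 ≤ alg.worstCaseRegret hB T P σ :=
  (integral_nonneg fun x => alg.regret_nonneg hB T 0 x.1 x.2).trans
    (alg.expectedRegret_le_worstCaseRegret hB T P σ hA (θ := 0) (by simp))

/-- The worst case is at least the average over a finite family of parameters, and the average may
be bounded separately for each value of the internal randomness. -/
theorem le_worstCaseRegret_of_average (hA : ∀ a ∈ A, ‖a‖ ≤ 1) {ι : Type*} [Fintype ι] [Nonempty ι]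
    {θ : ι → EuclideanSpace ℝ (Fin d)} (hθ : ∀ s, ‖θ s‖ ≤ 1) {r : ℝ}
    (hr : ∀ ω, Fintype.card ι * r ≤ ∑ s, ∫ ξ, alg.regret hB T (θ s) ω ξ
      ∂(Measure.infinitePi fun _ : ℕ => gaussianReal 0 (σ ^ 2).toNNReal)) :
    r ≤ alg.worstCaseRegret hB T P σ := by
  set N := Measure.infinitePi fun _ : ℕ => gaussianReal 0 (σ ^ 2).toNNReal with hN
  have hint : ∀ s, Integrable (fun x : Ω × (ℕ → ℝ) => alg.regret hB T (θ s) x.1 x.2) (P.prod N) :=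
    fun s => alg.integrable_regret hB T hA (hθ s) _
  have hcard : (0 : ℝ) < Fintype.card ι := by exact_mod_cast Fintype.card_pos
  have hsum : Fintype.card ι * r ≤
      ∑ s, alg.expectedRegret hB T P (gaussianReal 0 (σ ^ 2).toNNReal) (θ s) := by
    calc Fintype.card ι * r = ∫ _ω, Fintype.card ι * r ∂P := by simp
      _ ≤ ∫ ω, ∑ s, ∫ ξ, alg.regret hB T (θ s) ω ξ ∂N ∂P :=
        integral_mono (integrable_const _)
          (integrable_finsetSum _ fun s _ => (hint s).integral_prod_left) hr
      _ = ∑ s, ∫ ω, ∫ ξ, alg.regret hB T (θ s) ω ξ ∂N ∂P :=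
        integral_finsetSum _ fun s _ => (hint s).integral_prod_left
      _ = _ := Finset.sum_congr rfl fun s _ => (integral_prod _ (hint s)).symm
  have hle : ∑ s, alg.expectedRegret hB T P (gaussianReal 0 (σ ^ 2).toNNReal) (θ s) ≤
      ∑ _s : ι, alg.worstCaseRegret hB T P σ :=
    Finset.sum_le_sum fun s _ => alg.expectedRegret_le_worstCaseRegret hB T P σ hA (hθ s)
  rw [Finset.sum_const, Finset.card_univ, nsmul_eq_mul] at hle
  exact le_of_mul_le_mul_left (hsum.trans hle) hcard

/-- Lower bound from the scarcity of feedback. After `j` batches the learner has seen one of `2 ^ j`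
lists of bits, so at each position of batch `j` at most `2 ^ j` arms are available to it. If no
arm is good for more than a fraction `2 ^ (-J)` of the parameters, at least half of the parameters
cause regret at every time of the first `J` batches. -/
theorem min_le_worstCaseRegret_of_spread (hA : ∀ a ∈ A, ‖a‖ ≤ 1) {ι : Type*} [Fintype ι]
    [Nonempty ι] {θ : ι → EuclideanSpace ℝ (Fin d)} (hθ : ∀ s, ‖θ s‖ = 1) (hθA : ∀ s, θ s ∈ A)
    {J : ℕ} (hJ : ∀ a ∈ A, (2 : ℝ) ^ J *
      (Finset.univ.filter fun s => 3 / 4 ≤ inner ℝ a (θ s)).card ≤ Fintype.card ι) :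
    min (T : ℝ) (B * J) / 8 ≤ alg.worstCaseRegret hB T P σ := by
  classical
  set N := Measure.infinitePi fun _ : ℕ => gaussianReal 0 (σ ^ 2).toNNReal with hN
  refine alg.le_worstCaseRegret_of_average hB T P σ hA (fun s => (hθ s).le) fun ω => ?_
  have hint : ∀ s, Integrable (fun ξ => alg.regret hB T (θ s) ω ξ) N := fun s =>
    Integrable.of_bound ((alg.measurable_regret hB T (θ s)).comp
      measurable_prodMk_left).aestronglyMeasurable (2 * T)
      (Filter.Eventually.of_forall fun ξ => by
        rw [Real.norm_of_nonneg (alg.regret_nonneg hB T (θ s) ω ξ)]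
        exact alg.regret_le hB T hA (hθ s).le ω ξ)
  rw [← integral_finsetSum _ fun s _ => hint s]
  suffices hpt : ∀ ξ, Fintype.card ι * (min (T : ℝ) (B * J) / 8) ≤
      ∑ s, alg.regret hB T (θ s) ω ξ by
    calc _ = ∫ _ξ, Fintype.card ι * (min (T : ℝ) (B * J) / 8) ∂N := by simp
      _ ≤ _ := integral_mono (integrable_const _) (integrable_finsetSum _ fun s _ => hint s) hpt
  intro ξ
  simp only [regret]
  rw [Finset.sum_comm]
  have hsub : Finset.range (min T (B * J)) ⊆ Finset.range T :=
    Finset.range_mono (min_le_left _ _)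
  refine le_trans ?_ (Finset.sum_le_sum_of_subset_of_nonneg hsub fun t _ _ =>
    Finset.sum_nonneg fun s _ => sub_nonneg.mpr
      (inner_le_iSup (θ s) (alg.action_mem hB (θ s) ω ξ t)))
  have hterm : ∀ t ∈ Finset.range (min T (B * J)), (Fintype.card ι : ℝ) / 8 ≤
      ∑ s, ((⨆ a : A, inner ℝ (a : EuclideanSpace ℝ (Fin d)) (θ s)) -
        inner ℝ (alg.action hB (θ s) ω ξ t) (θ s)) := by
    intro t ht
    have htJ : t / B < J := by
      rw [Nat.div_lt_iff_lt_mul hB, mul_comm]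
      exact (Finset.mem_range.mp ht).trans_le (min_le_right _ _)
    set i : Fin B := ⟨t % B, Nat.mod_lt t hB⟩
    set good := Finset.univ.filter fun s => 3 / 4 ≤ inner ℝ (alg.action hB (θ s) ω ξ t) (θ s)
      with hgood
    have hcover : good ⊆ (bitLists (t / B)).biUnion fun h => Finset.univ.filter fun s =>
        3 / 4 ≤ inner ℝ (alg.arms h ω i : EuclideanSpace ℝ (Fin d)) (θ s) := fun s hs =>
      Finset.mem_biUnion.mpr ⟨_, alg.bits_mem_bitLists (θ s) ω ξ (t / B),
        Finset.mem_filter.mpr ⟨Finset.mem_univ s, (Finset.mem_filter.mp hs).2⟩⟩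
    have hcard : (2 : ℝ) * good.card ≤ Fintype.card ι := by
      have h1 : (good.card : ℝ) ≤ ∑ h ∈ bitLists (t / B), ((Finset.univ.filter fun s =>
          3 / 4 ≤ inner ℝ (alg.arms h ω i : EuclideanSpace ℝ (Fin d)) (θ s)).card : ℝ) := by
        exact_mod_cast (Finset.card_le_card hcover).trans Finset.card_biUnion_le
      have h2 : ∑ h ∈ bitLists (t / B), ((Finset.univ.filter fun s =>
          3 / 4 ≤ inner ℝ (alg.arms h ω i : EuclideanSpace ℝ (Fin d)) (θ s)).card : ℝ) ≤
          ∑ _h ∈ bitLists (t / B), (Fintype.card ι : ℝ) / 2 ^ J :=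
        Finset.sum_le_sum fun h _ => by
          rw [le_div_iff₀' (by positivity)]
          exact hJ _ (Subtype.prop _)
      rw [Finset.sum_const, card_bitLists, nsmul_eq_mul, Nat.cast_pow, Nat.cast_ofNat] at h2
      have h3 : (2 : ℝ) * (2 ^ (t / B) * (Fintype.card ι / 2 ^ J)) ≤ Fintype.card ι := by
        have h4 : (2 : ℝ) ^ (t / B + 1) ≤ 2 ^ J := pow_le_pow_right₀ one_le_two htJ
        rw [← mul_assoc, ← pow_succ', mul_div_assoc', div_le_iff₀ (by positivity), mul_comm]
        exact mul_le_mul_of_nonneg_left h4 (Nat.cast_nonneg _)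
      linarith
    have hbad : ∀ s ∈ goodᶜ, (1 : ℝ) / 4 ≤
        (⨆ a : A, inner ℝ (a : EuclideanSpace ℝ (Fin d)) (θ s)) -
          inner ℝ (alg.action hB (θ s) ω ξ t) (θ s) := by
      intro s hs
      have h1 : inner ℝ (alg.action hB (θ s) ω ξ t) (θ s) < 3 / 4 := by
        simpa [hgood] using hs
      have h2 := inner_le_iSup (θ s) (hθA s)
      rw [real_inner_self_eq_norm_sq, hθ s] at h2
      linarith
    have hcompl : (goodᶜ.card : ℝ) = Fintype.card ι - good.card := by
      rw [Finset.card_compl, Nat.cast_sub (Finset.card_le_univ _)]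
    calc (Fintype.card ι : ℝ) / 8 ≤ goodᶜ.card * (1 / 4) := by rw [hcompl]; linarith
      _ ≤ ∑ s ∈ goodᶜ, ((⨆ a : A, inner ℝ (a : EuclideanSpace ℝ (Fin d)) (θ s)) -
          inner ℝ (alg.action hB (θ s) ω ξ t) (θ s)) := by
        rw [← nsmul_eq_mul]
        exact Finset.card_nsmul_le_sum _ _ _ hbad
      _ ≤ _ := Finset.sum_le_sum_of_subset_of_nonneg (Finset.subset_univ _) fun s _ _ =>
        sub_nonneg.mpr (inner_le_iSup (θ s) (alg.action_mem hB (θ s) ω ξ t))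
  calc (Fintype.card ι : ℝ) * (min (T : ℝ) (B * J) / 8)
      = (Finset.range (min T (B * J))).card • ((Fintype.card ι : ℝ) / 8) := by
        rw [Finset.card_range, nsmul_eq_mul]
        push_cast
        ring
    _ ≤ _ := Finset.card_nsmul_le_sum _ _ _ hterm

end OneBitAlgorithm

/-! ### Simultaneous bandit problems -/

/-- Resampling one coordinate of a uniformly distributed function leaves it uniformly
distributed. -/
theorem card_mul_sum_eq_sum_update {ι κ : Type*} [Fintype ι] [DecidableEq ι] [Fintype κ]
    (G : (ι → κ) → ℝ) (b : ι) :
    Fintype.card κ * ∑ s, G s = ∑ s, ∑ i, G (Function.update s b i) := by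
  rw [← Fintype.sum_prod_type' (f := fun s i => G (Function.update s b i))]
  have hinv : Function.Involutive
      fun x : (ι → κ) × κ => (Function.update x.1 b x.2, x.1 b) := fun x => by simp
  rw [← Equiv.sum_comp hinv.toPerm]
  simp [Fintype.sum_prod_type, Finset.mul_sum]

theorem sum_range_mul_div_mod {B : ℕ} (hB : 0 < B) (f : ℕ → Fin B → ℝ) (J : ℕ) :
    ∑ t ∈ Finset.range (J * B), f (t / B) ⟨t % B, Nat.mod_lt t hB⟩ =
      ∑ j ∈ Finset.range J, ∑ i, f j i := by
  induction J with
  | zero => simp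
  | succ J ih =>
    rw [Nat.succ_mul, Finset.sum_range_add, ih, Finset.sum_range_succ,
      Finset.sum_range fun x => f ((J * B + x) / B) ⟨(J * B + x) % B, Nat.mod_lt _ hB⟩]
    congr 1
    refine Finset.sum_congr rfl fun i _ => ?_
    have h1 : (J * B + i) / B = J := by
      rw [mul_comm, Nat.mul_add_div hB, Nat.div_eq_of_lt i.2, add_zero]
    have h2 : (J * B + (i : ℕ)) % B = i := by
      rw [mul_comm, Nat.mul_add_mod, Nat.mod_eq_of_lt i.2]
    simp only [h1, h2]

/-- For `m` bandit problems with `n` options each, played simultaneously with one common reward,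
`x b i h j` is the weight put on option `i` of problem `b` at position `j` of the batch following
the bits `h`, and the mean reward under `s` is `Δ` times the total weight put on the options `s b`,
up to a constant. If `Δ ^ 2 T` is small compared with `v n`, then on average over `s` at most
three quarters of the weight goes to the options `s b`.

For each problem `b`, the model `s` is compared with the model in which the reward of problem `b`
is removed; the latter does not depend on `s b`, so that it puts an average weight of at most
`1 / n` on option `s b`. -/
theorem sum_weight_le {B m n T : ℕ} (hB : 0 < B) (hn : 2 ≤ n) {v : NNReal} (hv : v ≠ 0)
    {q : List Bool → (Fin B → ℝ) → Bool} (hq : ∀ h, Measurable (q h))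
    {x : Fin m → Fin n → List Bool → Fin B → ℝ} (hx0 : ∀ b i h j, 0 ≤ x b i h j)
    (hx1 : ∀ b h j, ∑ i, x b i h j ≤ 1) {Δ c : ℝ} (hΔ : 8 * (Δ ^ 2 * T) ≤ v * n)
    {μ : (Fin m → Fin n) → List Bool → Fin B → ℝ}
    (hμ : ∀ s h j, μ s h j = Δ * ∑ b, x b (s b) h j + c) :
    ∑ s, ∑ b, ∑ t ∈ Finset.range T, ∑ h ∈ bitLists (t / B), pathWeight (bitProb v q (μ s)) h *
      x b (s b) h ⟨t % B, Nat.mod_lt t hB⟩ ≤ Fintype.card (Fin m → Fin n) * (m * (T * (3 / 4))) := by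
  have hvpos : (0 : ℝ) < v := by exact_mod_cast pos_iff_ne_zero.mpr hv
  have hnpos : (2 : ℝ) ≤ n := by exact_mod_cast hn
  -- The means, path weights and expected weights when the reward of problem `b` is removed.
  set μ₀ : Fin m → (Fin m → Fin n) → List Bool → Fin B → ℝ :=
    fun b s h j => μ s h j - Δ * x b (s b) h j with hμ₀
  set W₀ : Fin m → (Fin m → Fin n) → List Bool → ℝ :=
    fun b s => pathWeight (bitProb v q (μ₀ b s)) with hW₀
  have hW₀nn : ∀ b s h, 0 ≤ W₀ b s h := fun b s h => pathWeight_nonneg bitProb_nonneg h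
  set G : Fin m → (Fin m → Fin n) → Fin n → ℝ := fun b s i => ∑ t ∈ Finset.range T,
    ∑ h ∈ bitLists (t / B), W₀ b s h * x b i h ⟨t % B, Nat.mod_lt t hB⟩ with hG
  have hx_le : ∀ b i h j, x b i h j ≤ 1 := fun b i h j =>
    (Finset.single_le_sum (fun i _ => hx0 b i h j) (Finset.mem_univ i)).trans (hx1 b h j)
  set κ : ℝ := Δ ^ 2 / (2 * v) with hκ
  have hκ0 : 0 ≤ κ := by positivity
  have hcompare : ∀ b s, ∑ t ∈ Finset.range T, ∑ h ∈ bitLists (t / B),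
      pathWeight (bitProb v q (μ s)) h * x b (s b) h ⟨t % B, Nat.mod_lt t hB⟩ ≤
      G b s (s b) + T * (1 / 8 + 2 * (κ * G b s (s b))) := by
    intro b s
    have hstep : ∀ t ∈ Finset.range T, ∑ h ∈ bitLists (t / B),
        pathWeight (bitProb v q (μ s)) h * x b (s b) h ⟨t % B, Nat.mod_lt t hB⟩ ≤
        ∑ h ∈ bitLists (t / B), W₀ b s h * x b (s b) h ⟨t % B, Nat.mod_lt t hB⟩ +
          (1 / 8 + 2 * (κ * G b s (s b))) := by
      intro t ht
      have hmain := sum_pathWeight_bitProb_le (μ := μ₀ b s) (μ' := μ s) hv hq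
        (u := fun h => x b (s b) h ⟨t % B, Nat.mod_lt t hB⟩)
        (fun h => ⟨hx0 _ _ _ _, hx_le _ _ _ _⟩) (t / B)
      have hkl : ∑ j ∈ Finset.range (t / B), ∑ h ∈ bitLists j, W₀ b s h *
          ∑ i, (μ s h i - μ₀ b s h i) ^ 2 / (2 * v) ≤ κ * G b s (s b) := by
        calc _ ≤ ∑ j ∈ Finset.range (t / B), ∑ h ∈ bitLists j, W₀ b s h *
              ∑ i, κ * x b (s b) h i := by
              refine Finset.sum_le_sum fun j _ => Finset.sum_le_sum fun h _ =>
                mul_le_mul_of_nonneg_left (Finset.sum_le_sum fun i _ => ?_) (hW₀nn b s h)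
              have h1 : (μ s h i - μ₀ b s h i) ^ 2 / (2 * v) = κ * x b (s b) h i ^ 2 := by
                simp only [hμ₀, hκ]; ring
              rw [h1]
              exact mul_le_mul_of_nonneg_left
                (pow_le_of_le_one (hx0 _ _ _ _) (hx_le _ _ _ _) two_ne_zero) hκ0
          _ = κ * ∑ j ∈ Finset.range (t / B), ∑ i, ∑ h ∈ bitLists j,
              W₀ b s h * x b (s b) h i := by
              rw [Finset.mul_sum]
              refine Finset.sum_congr rfl fun j _ => ?_
              rw [Finset.sum_comm, Finset.mul_sum]
              refine Finset.sum_congr rfl fun h _ => ?_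
              rw [← Finset.mul_sum, ← Finset.mul_sum]
              ring
          _ = κ * ∑ t' ∈ Finset.range (t / B * B), ∑ h ∈ bitLists (t' / B),
              W₀ b s h * x b (s b) h ⟨t' % B, Nat.mod_lt t' hB⟩ := by
              rw [sum_range_mul_div_mod hB fun j i => ∑ h ∈ bitLists j, W₀ b s h * x b (s b) h i]
          _ ≤ κ * G b s (s b) := by
              refine mul_le_mul_of_nonneg_left ?_ hκ0
              refine Finset.sum_le_sum_of_subset_of_nonneg (Finset.range_mono ?_) fun t' _ _ =>
                Finset.sum_nonneg fun h _ => mul_nonneg (hW₀nn b s h) (hx0 _ _ _ _)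
              exact (Nat.div_mul_le_self t B).trans (Finset.mem_range.mp ht).le
      simp only [hW₀] at hkl ⊢
      linarith
    refine (Finset.sum_le_sum hstep).trans_eq ?_
    rw [Finset.sum_add_distrib, Finset.sum_const, Finset.card_range, nsmul_eq_mul]
  have haverage : ∀ b, n * ∑ s, G b s (s b) ≤ Fintype.card (Fin m → Fin n) * T := by
    intro b
    have hres := card_mul_sum_eq_sum_update (fun s : Fin m → Fin n => G b s (s b)) b
    rw [Fintype.card_fin] at hres
    rw [hres]
    have hind : ∀ s i, G b (Function.update s b i) (Function.update s b i b) = G b s i := by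
      intro s i
      have : μ₀ b (Function.update s b i) = μ₀ b s := by
        ext h j
        simp only [hμ₀, hμ, ← Finset.add_sum_erase _ _ (Finset.mem_univ b),
          Function.update_self]
        have : ∑ b' ∈ Finset.univ.erase b, x b' (Function.update s b i b') h j =
            ∑ b' ∈ Finset.univ.erase b, x b' (s b') h j :=
          Finset.sum_congr rfl fun b' hb' => by
            rw [Function.update_of_ne (Finset.ne_of_mem_erase hb')]
        rw [this]
        ring
      simp only [hG, hW₀, this, Function.update_self]
    have hrow : ∀ s, ∑ i, G b s i ≤ T := by
      intro s
      rw [Finset.sum_comm]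
      calc _ ≤ ∑ _t ∈ Finset.range T, (1 : ℝ) := Finset.sum_le_sum fun t _ => by
            rw [Finset.sum_comm, ← sum_pathWeight (sum_bitProb (v := v) (μ := μ₀ b s) hq) (t / B)]
            refine Finset.sum_le_sum fun h _ => ?_
            rw [← Finset.mul_sum]
            exact mul_le_of_le_one_right (hW₀nn b s h) (hx1 _ _ _)
        _ = T := by simp
    simp_rw [hind]
    calc _ ≤ ∑ _s : Fin m → Fin n, (T : ℝ) := Finset.sum_le_sum fun s _ => hrow s
      _ = _ := by rw [Finset.sum_const, Finset.card_univ, nsmul_eq_mul]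
  set S : ℝ := (Fintype.card (Fin m → Fin n) : ℝ)
  have hS : 0 ≤ S := Nat.cast_nonneg _
  have hT : (0 : ℝ) ≤ T := Nat.cast_nonneg _
  have hprob : ∀ b, ∑ s, ∑ t ∈ Finset.range T, ∑ h ∈ bitLists (t / B),
      pathWeight (bitProb v q (μ s)) h * x b (s b) h ⟨t % B, Nat.mod_lt t hB⟩ ≤
      S * (T * (3 / 4)) := by
    intro b
    refine (Finset.sum_le_sum fun s _ => hcompare b s).trans ?_
    have hGnn : 0 ≤ ∑ s, G b s (s b) := Finset.sum_nonneg fun s _ => Finset.sum_nonneg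
      fun t _ => Finset.sum_nonneg fun h _ => mul_nonneg (hW₀nn b s h) (hx0 _ _ _ _)
    rw [Finset.sum_add_distrib, ← Finset.mul_sum, Finset.sum_add_distrib, ← Finset.mul_sum,
      ← Finset.mul_sum, Finset.sum_const, Finset.card_univ, nsmul_eq_mul]
    set g := ∑ s, G b s (s b)
    have hg := haverage b
    have h1 : g ≤ S * T / 2 := by nlinarith
    have h2 : T * κ * 16 ≤ n := by
      rw [hκ, mul_div_assoc', div_mul_eq_mul_div, div_le_iff₀ (by positivity)]
      linarith
    have h3 : 16 * (T * κ * g) ≤ S * T := by nlinarith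
    have h4 : T * (S * (1 / 8) + 2 * (κ * g)) = S * T / 8 + 2 * (T * κ * g) := by ring
    rw [h4]
    linarith
  rw [Finset.sum_comm]
  calc _ ≤ ∑ _b : Fin m, S * (T * (3 / 4)) := Finset.sum_le_sum fun b _ => hprob b
    _ = _ := by rw [Finset.sum_const, Finset.card_univ, Fintype.card_fin, nsmul_eq_mul]; ring

namespace OneBitAlgorithm

variable {d : ℕ} {A : Finset (EuclideanSpace ℝ (Fin d))} {B : ℕ} {Ω : Type*} [MeasurableSpace Ω]
  (alg : OneBitAlgorithm A B Ω)

theorem integrable_comp_bits (θ : EuclideanSpace ℝ (Fin d)) (N : Measure (ℕ → ℝ))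
    [IsFiniteMeasure N] (ω : Ω) (m : ℕ) (F : List Bool → ℝ) :
    Integrable (fun ξ => F (alg.bits θ ω ξ m)) N :=
  Integrable.of_bound ((alg.measurable_comp_bits θ m (G := fun h _ => F h) fun _ =>
    measurable_const).comp (measurable_prodMk_left (x := ω))).aestronglyMeasurable
    (∑ h ∈ bitLists m, ‖F h‖) (Filter.Eventually.of_forall fun ξ =>
      Finset.single_le_sum (f := fun h => ‖F h‖) (fun _ _ => norm_nonneg _)
        (alg.bits_mem_bitLists θ ω ξ m))

/-- Lower bound from the noise, for `m` simultaneous bandit problems with `n` options each: `w b i`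
is the weight that an arm puts on option `i` of problem `b`. -/
theorem mul_le_worstCaseRegret_of_problems (hB : 0 < B) (T : ℕ) (P : Measure Ω)
    [IsProbabilityMeasure P] {σ : ℝ} (hσ : 0 < σ) (hA : ∀ a ∈ A, ‖a‖ ≤ 1) {m n : ℕ} (hn : 2 ≤ n)
    {w : Fin m → Fin n → EuclideanSpace ℝ (Fin d) → ℝ} (hw0 : ∀ b i, ∀ a ∈ A, 0 ≤ w b i a)
    (hw1 : ∀ b, ∀ a ∈ A, ∑ i, w b i a ≤ 1) {θ : (Fin m → Fin n) → EuclideanSpace ℝ (Fin d)}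
    (hθ : ∀ s, ‖θ s‖ ≤ 1) {Δ c : ℝ} (hΔ0 : 0 ≤ Δ) (hΔ : 8 * (Δ ^ 2 * T) ≤ σ ^ 2 * n)
    (hinner : ∀ s, ∀ a ∈ A, inner ℝ a (θ s) = Δ * ∑ b, w b (s b) a + c)
    (hsup : ∀ s, ∃ a ∈ A, inner ℝ a (θ s) = Δ * m + c) :
    T * (m * Δ) / 4 ≤ alg.worstCaseRegret hB T P σ := by
  have : Nonempty (Fin n) := ⟨⟨0, by omega⟩⟩
  have hv : (σ ^ 2).toNNReal ≠ 0 := (Real.toNNReal_pos.mpr (by positivity)).ne'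
  have hvσ : ((σ ^ 2).toNNReal : ℝ) = σ ^ 2 := Real.coe_toNNReal _ (sq_nonneg σ)
  refine alg.le_worstCaseRegret_of_average hB T P σ hA hθ fun ω => ?_
  set μ : (Fin m → Fin n) → List Bool → Fin B → ℝ :=
    fun s h i => inner ℝ (alg.arms h ω i : EuclideanSpace ℝ (Fin d)) (θ s) with hμ
  have hq : ∀ h, Measurable (alg.quantizer h ω) := fun h =>
    (alg.measurable_quantizer h).comp measurable_prodMk_left
  have hweight := sum_weight_le (T := T) hB hn hv hq
    (x := fun b i h j => w b i (alg.arms h ω j))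
    (fun b i _ _ => hw0 b i _ (Subtype.prop _)) (fun b _ _ => hw1 b _ (Subtype.prop _))
    (hΔ.trans_eq (by rw [hvσ])) (μ := μ) (c := c) fun s _ _ => hinner s _ (Subtype.prop _)
  have hregret : ∀ s, T * (m * Δ) - Δ * ∑ b, ∑ t ∈ Finset.range T, ∑ h ∈ bitLists (t / B),
      pathWeight (bitProb (σ ^ 2).toNNReal (fun h => alg.quantizer h ω) (μ s)) h *
        w b (s b) (alg.arms h ω ⟨t % B, Nat.mod_lt t hB⟩) ≤
      ∫ ξ, alg.regret hB T (θ s) ω ξ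
        ∂(Measure.infinitePi fun _ : ℕ => gaussianReal 0 (σ ^ 2).toNNReal) := by
    intro s
    obtain ⟨a, ha, hval⟩ := hsup s
    have hmax : Δ * m + c ≤ ⨆ a : A, inner ℝ (a : EuclideanSpace ℝ (Fin d)) (θ s) :=
      hval ▸ inner_le_iSup (θ s) ha
    have hint : ∀ t, Integrable (fun ξ => inner ℝ (alg.action hB (θ s) ω ξ t) (θ s))
        (Measure.infinitePi fun _ : ℕ => gaussianReal 0 (σ ^ 2).toNNReal) := fun t =>
      alg.integrable_comp_bits (θ s) _ ω (t / B) fun h => μ s h ⟨t % B, Nat.mod_lt t hB⟩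
    have hint' : ∀ t ∈ Finset.range T, Integrable (fun ξ =>
        (⨆ a : A, inner ℝ (a : EuclideanSpace ℝ (Fin d)) (θ s)) -
          inner ℝ (alg.action hB (θ s) ω ξ t) (θ s))
        (Measure.infinitePi fun _ : ℕ => gaussianReal 0 (σ ^ 2).toNNReal) := fun t _ =>
      (integrable_const _).sub (hint t)
    simp only [regret]
    rw [integral_finsetSum _ hint', Finset.sum_comm,
      Finset.mul_sum]
    have hconst : (T : ℝ) * (m * Δ) = ∑ _t ∈ Finset.range T, (m * Δ : ℝ) := by simp
    rw [hconst, ← Finset.sum_sub_distrib]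
    refine Finset.sum_le_sum fun t _ => ?_
    rw [integral_sub (integrable_const _) (hint t)]
    have hval' : ∫ ξ, inner ℝ (alg.action hB (θ s) ω ξ t) (θ s)
        ∂(Measure.infinitePi fun _ : ℕ => gaussianReal 0 (σ ^ 2).toNNReal) =
        Δ * ∑ b, ∑ h ∈ bitLists (t / B),
          pathWeight (bitProb (σ ^ 2).toNNReal (fun h => alg.quantizer h ω) (μ s)) h *
            w b (s b) (alg.arms h ω ⟨t % B, Nat.mod_lt t hB⟩) + c := by
      have h1 := alg.integral_comp_bits (θ s) (σ ^ 2).toNNReal ω (t / B)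
        fun h => μ s h ⟨t % B, Nat.mod_lt t hB⟩
      refine h1.trans ?_
      change ∑ h ∈ bitLists (t / B), pathWeight (bitProb (σ ^ 2).toNNReal
        (fun h => alg.quantizer h ω) (μ s)) h * μ s h ⟨t % B, Nat.mod_lt t hB⟩ = _
      have h2 := sum_pathWeight (sum_bitProb (v := (σ ^ 2).toNNReal) (μ := μ s) hq) (t / B)
      have h4 : c = ∑ h ∈ bitLists (t / B), pathWeight (bitProb (σ ^ 2).toNNReal
          (fun h => alg.quantizer h ω) (μ s)) h * c := by
        rw [← Finset.sum_mul, h2, one_mul]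
      rw [Finset.sum_comm, Finset.mul_sum, h4, ← Finset.sum_add_distrib]
      refine Finset.sum_congr rfl fun h _ => ?_
      have h3 : μ s h ⟨t % B, Nat.mod_lt t hB⟩ = Δ * ∑ b, w b (s b)
          (alg.arms h ω ⟨t % B, Nat.mod_lt t hB⟩) + c := hinner s _ (Subtype.prop _)
      rw [h3, ← Finset.mul_sum]
      ring
    rw [hval']
    simp only [integral_const, probReal_univ, one_smul]
    linarith
  refine le_trans ?_ (Finset.sum_le_sum fun s _ => hregret s)
  rw [Finset.sum_sub_distrib, Finset.sum_const, Finset.card_univ, nsmul_eq_mul, ← Finset.mul_sum]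
  have := mul_le_mul_of_nonneg_left hweight hΔ0
  linarith

end OneBitAlgorithm

/-! ### Spread action sets -/

/-- A finite subset of an infinite set can be enlarged within it to any larger size. -/
theorem Set.Infinite.exists_finset_superset_card_eq {α : Type*} {C : Set α} (hC : C.Infinite)
    {S : Finset α} (hS : ∀ x ∈ S, x ∈ C) {K : ℕ} (hK : S.card ≤ K) :
    ∃ A : Finset α, S ⊆ A ∧ (∀ x ∈ A, x ∈ C) ∧ A.card = K := by
  classical
  obtain ⟨R, hR, hcard⟩ := (hC.sdiff S.finite_toSet).exists_subset_card_eq (K - S.card)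
  refine ⟨S ∪ R, Finset.subset_union_left, fun x hx => ?_, ?_⟩
  · rcases Finset.mem_union.mp hx with h | h
    · exact hS x h
    · exact (hR h).1
  · have hdisj : Disjoint S R := Finset.disjoint_right.mpr fun x hx hxS => (hR hx).2 hxS
    rw [Finset.card_union_of_disjoint hdisj, hcard]
    omega

section coordVec

variable {d : ℕ} {ι : Type*} [Fintype ι]

/-- The vector of `ℝ ^ d` whose coordinate `e b` is `f b`, the other coordinates being `0` (for an
injective `e`). -/
noncomputable def coordVec (e : ι → Fin d) (f : ι → ℝ) : EuclideanSpace ℝ (Fin d) :=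
  ∑ b, f b • EuclideanSpace.single (e b) (1 : ℝ)

theorem inner_coordVec (e : ι → Fin d) (f : ι → ℝ) (a : EuclideanSpace ℝ (Fin d)) :
    inner ℝ a (coordVec e f) = ∑ b, f b * a (e b) := by
  simp [coordVec, inner_sum, inner_smul_right, EuclideanSpace.inner_single_right]

theorem coordVec_apply (e : ι → Fin d) (f : ι → ℝ) (l : Fin d) :
    coordVec e f l = ∑ b, if l = e b then f b else 0 := by
  simp [coordVec, Finset.sum_apply, Pi.single_apply]

theorem coordVec_apply_self {e : ι → Fin d} (he : Function.Injective e) (f : ι → ℝ) (b : ι) :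
    coordVec e f (e b) = f b := by
  classical
  simp [coordVec_apply, he.eq_iff]

theorem norm_sq_coordVec {e : ι → Fin d} (he : Function.Injective e) (f : ι → ℝ) :
    ‖coordVec e f‖ ^ 2 = ∑ b, f b ^ 2 := by
  rw [← real_inner_self_eq_norm_sq, inner_coordVec]
  simp_rw [coordVec_apply_self he, sq]

theorem sum_sq_apply_le {e : ι → Fin d} (he : Function.Injective e)
    {a : EuclideanSpace ℝ (Fin d)} (ha : ‖a‖ ≤ 1) : ∑ b, a (e b) ^ 2 ≤ 1 := by
  have h1 : ∑ b, a (e b) ^ 2 = ∑ l ∈ Finset.univ.map ⟨e, he⟩, a l ^ 2 := by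
    rw [Finset.sum_map]; rfl
  have h2 : ∑ l, a l ^ 2 ≤ 1 := by
    rw [← EuclideanSpace.real_norm_sq_eq]
    exact pow_le_one₀ (norm_nonneg a) ha
  rw [h1]
  exact (Finset.sum_le_sum_of_subset_of_nonneg (Finset.subset_univ _)
    fun l _ _ => sq_nonneg _).trans h2

end coordVec

theorem span_eq_top_of_single_mem {d : ℕ} {A : Finset (EuclideanSpace ℝ (Fin d))} {r : ℝ}
    (hr : r ≠ 0) (hA : ∀ l, EuclideanSpace.single l r ∈ A) :
    Submodule.span ℝ (A : Set (EuclideanSpace ℝ (Fin d))) = ⊤ := by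
  rw [eq_top_iff, ← (EuclideanSpace.basisFun (Fin d) ℝ).toBasis.span_eq, Submodule.span_le]
  rintro _ ⟨l, rfl⟩
  have h := Submodule.smul_mem _ r⁻¹ (Submodule.subset_span (R := ℝ) (Finset.mem_coe.mpr (hA l)))
  have heq : r⁻¹ • EuclideanSpace.single l r = EuclideanSpace.single l (1 : ℝ) := by
    ext j
    simp [hr]
  rw [heq] at h
  simpa using h

theorem infinite_closedBall {d : ℕ} (hd : 1 ≤ d) :
    (Metric.closedBall (0 : EuclideanSpace ℝ (Fin d)) 1).Infinite := by
  refine Set.infinite_of_injOn_mapsTo (s := Set.Icc (0 : ℝ) 1)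
    (f := fun t => EuclideanSpace.single (⟨0, hd⟩ : Fin d) t) ?_ ?_ (Set.Icc_infinite one_pos)
  · intro t _ t' _ h
    simpa using congrArg (fun v : EuclideanSpace ℝ (Fin d) => v ⟨0, hd⟩) h
  · intro t ht
    simp [abs_of_nonneg ht.1, ht.2]

theorem log_natCast_le_mul_log (b : ℕ) {K : ℕ} (hb : 1 < b) (hK : 0 < K) :
    Real.log K ≤ (Nat.log b K + 1) * Real.log b := by
  have h : (K : ℝ) ≤ b ^ (Nat.log b K + 1) := by
    exact_mod_cast (Nat.lt_pow_succ_log_self hb K).le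
  have := Real.log_le_log (by exact_mod_cast hK) h
  rwa [Real.log_pow, Nat.cast_succ] at this

theorem card_filter_inner_single_le {d : ℕ} {a : EuclideanSpace ℝ (Fin d)} (ha : ‖a‖ ≤ 1) :
    (Finset.univ.filter fun l : Fin d =>
      3 / 4 ≤ inner ℝ a (EuclideanSpace.single l (1 : ℝ))).card ≤ 1 := by
  refine Finset.card_le_one.mpr fun i hi j hj => ?_
  by_contra hij
  simp only [Finset.mem_filter, Finset.mem_univ, true_and, EuclideanSpace.inner_single_right,
    one_mul, conj_trivial] at hi hj
  have he : Function.Injective ![i, j] := by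
    intro x y hxy
    fin_cases x <;> fin_cases y <;> simp_all
  have := sum_sq_apply_le he ha
  simp only [Fin.sum_univ_two, Matrix.cons_val_zero, Matrix.cons_val_one] at this
  nlinarith

/-- The vertices of the cube spanned by the coordinates `e b`, normalised. -/
noncomputable def cubeVertex {d h : ℕ} (e : Fin h → Fin d) (s : Fin h → Bool) :
    EuclideanSpace ℝ (Fin d) :=
  coordVec e fun b => (if s b then 1 else -1) / √h

section cubeVertex

variable {d h : ℕ} {e : Fin h → Fin d}

theorem norm_cubeVertex (hh : 0 < h) (he : Function.Injective e) (s : Fin h → Bool) :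
    ‖cubeVertex e s‖ = 1 := by
  have h1 : ‖cubeVertex e s‖ ^ 2 = 1 := by
    have hpos : (0 : ℝ) < h := by exact_mod_cast hh
    rw [cubeVertex, norm_sq_coordVec he]
    have : ∀ b, ((if s b then 1 else -1) / √h : ℝ) ^ 2 = 1 / h := fun b => by
      rw [div_pow, Real.sq_sqrt hpos.le]; split_ifs <;> norm_num
    simp_rw [this]
    simp [hpos.ne']
  exact (pow_eq_one_iff_of_nonneg (norm_nonneg _) two_ne_zero).mp h1

theorem two_mul_card_filter_inner_cubeVertex_le (a : EuclideanSpace ℝ (Fin d)) :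
    2 * (Finset.univ.filter fun s => 3 / 4 ≤ inner ℝ a (cubeVertex e s)).card ≤
      Fintype.card (Fin h → Bool) := by
  classical
  set good := Finset.univ.filter fun s => 3 / 4 ≤ inner ℝ a (cubeVertex e s) with hgood
  have hneg : ∀ s, inner ℝ a (cubeVertex e fun b => !s b) = -inner ℝ a (cubeVertex e s) := by
    intro s
    simp only [cubeVertex, inner_coordVec, ← Finset.sum_neg_distrib]
    refine Finset.sum_congr rfl fun b _ => ?_
    by_cases hb : s b = true
    · simp [hb]; ring
    · simp [hb]; ring
  have hle : good.card ≤ goodᶜ.card := by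
    refine Finset.card_le_card_of_injOn (fun s b => !s b) (fun s hs => ?_) fun s _ s' _ hss => ?_
    · simp only [hgood, Finset.coe_filter, Finset.mem_univ, true_and, Set.mem_ofPred_eq,
        Finset.coe_compl, Set.mem_compl_iff, not_le] at hs ⊢
      rw [hneg]
      linarith
    · funext b
      simpa using congrFun hss b
  rw [Finset.card_compl] at hle
  have := Finset.card_le_univ good
  omega

/-- Chernoff bound: only a small fraction of the cube is well aligned with a given vector. -/
theorem exp_mul_card_filter_inner_cubeVertex_le (hh : 0 < h) (he : Function.Injective e)
    {a : EuclideanSpace ℝ (Fin d)} (ha : ‖a‖ ≤ 1) :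
    Real.exp (h / 4) *
      (Finset.univ.filter fun s => 3 / 4 ≤ inner ℝ a (cubeVertex e s)).card ≤
      Fintype.card (Fin h → Bool) := by
  have hpos : (0 : ℝ) < h := by exact_mod_cast hh
  set good := Finset.univ.filter fun s => 3 / 4 ≤ inner ℝ a (cubeVertex e s) with hgood
  -- The optimal exponent would be `3 h / 4`; `h / 2` gives simpler numbers.
  have hmgf : ∑ s, Real.exp (h / 2 * inner ℝ a (cubeVertex e s)) ≤ 2 ^ h * Real.exp (h / 8) := by
    calc ∑ s, Real.exp (h / 2 * inner ℝ a (cubeVertex e s))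
        = ∑ s : Fin h → Bool, ∏ b, Real.exp (h / 2 * ((if s b then 1 else -1) / √h * a (e b))) := by
          refine Finset.sum_congr rfl fun s _ => ?_
          rw [cubeVertex, inner_coordVec, Finset.mul_sum, Real.exp_sum]
      _ = ∏ b : Fin h, ∑ x : Bool, Real.exp (h / 2 * ((if x then 1 else -1) / √h * a (e b))) := by
          rw [Fintype.prod_sum fun (b : Fin h) (x : Bool) =>
            Real.exp (h / 2 * ((if x then 1 else -1) / √h * a (e b)))]
      _ ≤ ∏ b : Fin h, 2 * Real.exp (h / 8 * a (e b) ^ 2) := by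
          refine Finset.prod_le_prod (fun b _ => by positivity) fun b _ => ?_
          have hc := Real.cosh_le_exp_half_sq (h / 2 * (1 / √h * a (e b)))
          have hsq : (h / 2 * (1 / √h * a (e b))) ^ 2 / 2 = h / 8 * a (e b) ^ 2 := by
            rw [mul_pow, mul_pow, div_pow 1, Real.sq_sqrt hpos.le]
            field_simp
            ring
          rw [hsq, Real.cosh_eq, div_le_iff₀ two_pos] at hc
          rw [Fintype.sum_bool]
          refine le_of_eq_of_le ?_ (hc.trans_eq (mul_comm _ _))
          simp [neg_div]
      _ = 2 ^ h * Real.exp (h / 8 * ∑ b, a (e b) ^ 2) := by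
          rw [Finset.prod_mul_distrib, ← Real.exp_sum, ← Finset.mul_sum]
          simp
      _ ≤ 2 ^ h * Real.exp (h / 8) := by
          gcongr
          exact mul_le_of_le_one_right (by positivity) (sum_sq_apply_le he ha)
  have hgoodsum : good.card * Real.exp (h / 2 * (3 / 4)) ≤ 2 ^ h * Real.exp (h / 8) := by
    rw [← nsmul_eq_mul]
    refine (Finset.card_nsmul_le_sum good _ _ fun s hs => ?_).trans
      ((Finset.sum_le_sum_of_subset_of_nonneg (Finset.subset_univ good)
        fun s _ _ => (Real.exp_pos _).le).trans hmgf)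
    rw [Real.exp_le_exp]
    exact mul_le_mul_of_nonneg_left (Finset.mem_filter.mp hs).2 (by positivity)
  have hsplit : Real.exp (h / 2 * (3 / 4) : ℝ) = Real.exp (h / 4) * Real.exp (h / 8) := by
    rw [← Real.exp_add]; congr 1; ring
  rw [hsplit, ← mul_assoc] at hgoodsum
  have := le_of_mul_le_mul_right hgoodsum (Real.exp_pos _)
  rw [Fintype.card_fun, Fintype.card_bool, Fintype.card_fin]
  push_cast
  linarith

end cubeVertex

/-- An action set of size `K` in the unit ball that contains a family of unit vectors, only a
fraction `2 ^ (-J)` of which is well aligned with any given action, with `J` of the order of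
`min d (log K)`. For `K < 2 d` the family is the standard basis, otherwise it is a cube. -/
theorem exists_spread_actionSet {d K : ℕ} (hd : 1 ≤ d) (hdK : d ≤ K) (hK : 2 ≤ K) :
    ∃ (A : Finset (EuclideanSpace ℝ (Fin d))) (J : ℕ), A.card = K ∧ (∀ a ∈ A, ‖a‖ ≤ 1) ∧
      Submodule.span ℝ (A : Set (EuclideanSpace ℝ (Fin d))) = ⊤ ∧
      min (d : ℝ) (Real.log K) ≤ 24 * J ∧
      ∃ (ι : Type) (_ : Fintype ι) (_ : Nonempty ι) (θ : ι → EuclideanSpace ℝ (Fin d)),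
        (∀ s, ‖θ s‖ = 1) ∧ (∀ s, θ s ∈ A) ∧ ∀ a ∈ A, (2 : ℝ) ^ J *
          (Finset.univ.filter fun s => 3 / 4 ≤ inner ℝ a (θ s)).card ≤ Fintype.card ι := by
  classical
  have hlog2 : Real.log 2 ≤ 1 := by linarith [Real.log_two_lt_d9]
  set E : Finset (EuclideanSpace ℝ (Fin d)) :=
    Finset.univ.image fun l => EuclideanSpace.single l (1 : ℝ)
  have hEcard : E.card ≤ d := Finset.card_image_le.trans_eq (by simp)
  have hEmem : ∀ l, EuclideanSpace.single l (1 : ℝ) ∈ E := fun l =>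
    Finset.mem_image_of_mem _ (Finset.mem_univ l)
  have hEball : ∀ a ∈ E, a ∈ Metric.closedBall (0 : EuclideanSpace ℝ (Fin d)) 1 := by
    intro a ha
    obtain ⟨l, -, rfl⟩ := Finset.mem_image.mp ha
    simp
  by_cases hcase : 2 ≤ d ∧ K < 2 * d
  · obtain ⟨hd2, hK2⟩ := hcase
    obtain ⟨A, hEA, hAball, hA⟩ := (infinite_closedBall hd).exists_finset_superset_card_eq hEball
      (hEcard.trans hdK)
    have hAnorm : ∀ a ∈ A, ‖a‖ ≤ 1 := fun a ha => mem_closedBall_zero_iff.mp (hAball a ha)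
    have hdpos : (0 : ℝ) < d := by exact_mod_cast hd
    refine ⟨A, Nat.log 2 d, hA, hAnorm,
      span_eq_top_of_single_mem one_ne_zero fun l => hEA (hEmem l), ?_, Fin d, inferInstance,
      ⟨⟨0, hd⟩⟩, fun l => EuclideanSpace.single l 1, by simp, fun l => hEA (hEmem l),
      fun a ha => ?_⟩
    · have h1 : Real.log K ≤ Real.log 2 + Real.log d := by
        rw [← Real.log_mul two_ne_zero hdpos.ne']
        exact Real.log_le_log (by positivity) (by exact_mod_cast hK2.le)
      have h2 := log_natCast_le_mul_log 2 one_lt_two hd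
      have h3 : (1 : ℝ) ≤ Nat.log 2 d := by exact_mod_cast Nat.log_pos one_lt_two hd2
      rw [Nat.cast_ofNat] at h2
      exact (min_le_right _ _).trans (by nlinarith)
    · have h1 : (2 : ℝ) ^ Nat.log 2 d ≤ d := by exact_mod_cast Nat.pow_log_le_self 2 (by omega)
      have h2 : ((Finset.univ.filter fun l : Fin d =>
          3 / 4 ≤ inner ℝ a (EuclideanSpace.single l (1 : ℝ))).card : ℝ) ≤ 1 := by
        exact_mod_cast card_filter_inner_single_le (hAnorm a ha)
      rw [Fintype.card_fin]
      exact (mul_le_of_le_one_right (by positivity) h2).trans h1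
  · obtain ⟨h, hh, hhd, hcard, hmin⟩ : ∃ h : ℕ, 0 < h ∧ h ≤ d ∧ (d = 1 ∨ 2 ^ h + d ≤ K) ∧
        min (d : ℝ) (Real.log K) ≤ 3 * h := by
      rcases hd.eq_or_lt with rfl | hd2
      · exact ⟨1, one_pos, le_rfl, Or.inl rfl, (min_le_left _ _).trans (by norm_num)⟩
      have hK2 : 2 * d ≤ K := by
        by_contra hlt
        exact hcase ⟨hd2, not_le.mp hlt⟩
      have hL : 2 ≤ Nat.log 2 K := (Nat.le_log_iff_pow_le one_lt_two (by omega)).mpr (by omega)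
      have hpow : 2 * 2 ^ (Nat.log 2 K - 1) ≤ K := by
        rw [← pow_succ', Nat.sub_add_cancel (by omega)]
        exact Nat.pow_log_le_self 2 (by omega)
      refine ⟨min d (Nat.log 2 K - 1), by omega, min_le_left _ _, Or.inr ?_, ?_⟩
      · have : 2 ^ min d (Nat.log 2 K - 1) ≤ 2 ^ (Nat.log 2 K - 1) :=
          Nat.pow_le_pow_right two_pos (min_le_right _ _)
        omega
      · rcases min_choice d (Nat.log 2 K - 1) with hm | hm <;> rw [hm]
        · exact (min_le_left _ _).trans (by have : (0 : ℝ) ≤ d := Nat.cast_nonneg d; linarith)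
        · have h2 := log_natCast_le_mul_log 2 one_lt_two (by omega : 0 < K)
          have h3 : (2 : ℝ) ≤ Nat.log 2 K := by exact_mod_cast hL
          rw [Nat.cast_ofNat] at h2
          rw [Nat.cast_sub (by omega), Nat.cast_one]
          exact (min_le_right _ _).trans (by nlinarith)
    set e : Fin h → Fin d := Fin.castLE hhd
    have he : Function.Injective e := Fin.castLE_injective hhd
    set V : Finset (EuclideanSpace ℝ (Fin d)) := Finset.univ.image (cubeVertex e)
    have hVcard : V.card ≤ 2 ^ h := Finset.card_image_le.trans_eq (by simp)
    have hVmem : ∀ s, cubeVertex e s ∈ V := fun s => Finset.mem_image_of_mem _ (Finset.mem_univ s)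
    have hVE : (V ∪ E).card ≤ K := by
      rcases hcard with rfl | hcard
      · -- In dimension one the cube contains the basis.
        obtain rfl : h = 1 := by omega
        have hEV : E ⊆ V := by
          intro a ha
          obtain ⟨l, -, rfl⟩ := Finset.mem_image.mp ha
          refine Finset.mem_image.mpr ⟨fun _ => true, Finset.mem_univ _, ?_⟩
          ext j
          fin_cases l
          fin_cases j
          simp [cubeVertex, coordVec_apply, e]
        rw [Finset.union_eq_left.mpr hEV]
        exact hVcard.trans hK
      · exact (Finset.card_union_le _ _).trans (by omega)
    obtain ⟨A, hVA, hAball, hA⟩ := (infinite_closedBall hd).exists_finset_superset_card_eq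
      (S := V ∪ E) (fun a ha => by
        rcases Finset.mem_union.mp ha with ha | ha
        · obtain ⟨s, -, rfl⟩ := Finset.mem_image.mp ha
          exact mem_closedBall_zero_iff.mpr (norm_cubeVertex hh he s).le
        · exact hEball a ha) hVE
    have hAnorm : ∀ a ∈ A, ‖a‖ ≤ 1 := fun a ha => mem_closedBall_zero_iff.mp (hAball a ha)
    refine ⟨A, max 1 (h / 4), hA, hAnorm,
      span_eq_top_of_single_mem one_ne_zero fun l => hVA (Finset.mem_union_right _ (hEmem l)),
      ?_, Fin h → Bool, inferInstance, inferInstance, cubeVertex e, norm_cubeVertex hh he,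
      fun s => hVA (Finset.mem_union_left _ (hVmem s)), fun a ha => ?_⟩
    · have : h ≤ 8 * max 1 (h / 4) := by omega
      have : (h : ℝ) ≤ 8 * (max 1 (h / 4) : ℕ) := by exact_mod_cast this
      linarith
    · rcases max_choice 1 (h / 4) with hm | hm <;> rw [hm]
      · rw [pow_one]
        exact_mod_cast two_mul_card_filter_inner_cubeVertex_le a
      · refine le_trans ?_ (exp_mul_card_filter_inner_cubeVertex_le hh he (hAnorm a ha))
        gcongr
        have h1 : ((h / 4 : ℕ) : ℝ) ≤ h / 4 := by exact_mod_cast Nat.cast_div_le (α := ℝ)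
        calc (2 : ℝ) ^ (h / 4) = Real.exp ((h / 4 : ℕ) * Real.log 2) := by
              rw [mul_comm, Real.exp_mul, Real.exp_log two_pos, Real.rpow_natCast]
          _ ≤ Real.exp (h / 4) := Real.exp_le_exp.mpr (by nlinarith [Nat.cast_nonneg (α := ℝ) (h / 4)])

/-! ### Action sets for simultaneous bandit problems -/

/-- The actions admitted for `m` simultaneous bandit problems with `n` options each, the coordinate
`e (b, i)` standing for option `i` of problem `b`: in each problem, the coordinates multiplied by
`√m` are the weights of the options. -/
def problemActions {d m n : ℕ} (e : Fin m × Fin n → Fin d) : Set (EuclideanSpace ℝ (Fin d)) :=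
  {a | ‖a‖ ≤ 1 ∧ (∀ l, 0 ≤ a l) ∧ ∀ b, ∑ i, √m * a (e (b, i)) ≤ 1}

/-- The action that puts all its weight on the option `s b` of each problem `b`. -/
noncomputable def problemVertex {d m n : ℕ} (e : Fin m × Fin n → Fin d) (s : Fin m → Fin n) :
    EuclideanSpace ℝ (Fin d) :=
  coordVec (fun b => e (b, s b)) fun _ => 1 / √m

section problemActions

variable {d m n : ℕ} {e : Fin m × Fin n → Fin d}

theorem inner_problemVertex (s : Fin m → Fin n) (a : EuclideanSpace ℝ (Fin d)) :
    m * inner ℝ a (problemVertex e s) = ∑ b, √m * a (e (b, s b)) := by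
  rw [problemVertex, inner_coordVec, Finset.mul_sum]
  refine Finset.sum_congr rfl fun b _ => ?_
  rw [← mul_assoc, mul_one_div, Real.div_sqrt]

theorem norm_problemVertex (hm : 0 < m) (he : Function.Injective e) (s : Fin m → Fin n) :
    ‖problemVertex e s‖ = 1 := by
  have hpos : (0 : ℝ) < m := by exact_mod_cast hm
  have hinj : Function.Injective fun b => e (b, s b) := fun b b' h => congrArg Prod.fst (he h)
  have h1 : ‖problemVertex e s‖ ^ 2 = 1 := by
    rw [problemVertex, norm_sq_coordVec hinj, div_pow, Real.sq_sqrt hpos.le]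
    simp [hpos.ne']
  exact (pow_eq_one_iff_of_nonneg (norm_nonneg _) two_ne_zero).mp h1

theorem problemVertex_mem (hm : 0 < m) (he : Function.Injective e) (s : Fin m → Fin n) :
    problemVertex e s ∈ problemActions e := by
  have hpos : (0 : ℝ) < m := by exact_mod_cast hm
  refine ⟨(norm_problemVertex hm he s).le, fun l => ?_, fun b => ?_⟩
  · rw [problemVertex, coordVec_apply]
    exact Finset.sum_nonneg fun b _ => by split_ifs <;> positivity
  · have : ∀ i, √m * problemVertex e s (e (b, i)) = if i = s b then 1 else 0 := by
      intro i
      rw [problemVertex, coordVec_apply, Finset.sum_eq_single b]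
      · simp only [he.eq_iff, Prod.mk.injEq, true_and]
        split_ifs
        · field_simp
        · simp
      · intro b' _ hb'
        exact if_neg fun h => hb' (congrArg Prod.fst (he h)).symm
      · simp
    simp [this]

theorem single_mem_problemActions (hm : 0 < m) (he : Function.Injective e) (l : Fin d) {t : ℝ}
    (ht : t ∈ Set.Icc 0 (1 / √m)) : EuclideanSpace.single l t ∈ problemActions e := by
  have hone : (1 : ℝ) ≤ √m := Real.one_le_sqrt.mpr (by exact_mod_cast hm)
  refine ⟨?_, fun j => ?_, fun b => ?_⟩
  · rw [PiLp.norm_single, Real.norm_of_nonneg ht.1]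
    exact ht.2.trans (div_le_one_of_le₀ hone (Real.sqrt_nonneg _))
  · by_cases hj : j = l
    · simpa [hj] using ht.1
    · simp [hj]
  · have ht1 : √m * t ≤ 1 := by
      have := mul_le_mul_of_nonneg_left ht.2 (Real.sqrt_nonneg m)
      rwa [mul_one_div_cancel (by positivity)] at this
    by_cases hl : ∃ i, e (b, i) = l
    · obtain ⟨i, rfl⟩ := hl
      rw [Finset.sum_eq_single i]
      · simpa using ht1
      · intro j _ hj
        have : e (b, j) ≠ e (b, i) := fun h => hj (congrArg Prod.snd (he h))
        simp [this]
      · simp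
    · push Not at hl
      have : ∀ i, √m * (EuclideanSpace.single l t : EuclideanSpace ℝ (Fin d)) (e (b, i)) = 0 :=
        fun i => by simp [hl i]
      rw [Finset.sum_eq_zero fun i _ => this i]
      exact zero_le_one

theorem infinite_problemActions (hd : 0 < d) (hm : 0 < m) (he : Function.Injective e) :
    (problemActions e).Infinite := by
  refine Set.infinite_of_injOn_mapsTo (s := Set.Icc (0 : ℝ) (1 / √m))
    (f := fun t => EuclideanSpace.single (⟨0, hd⟩ : Fin d) t) ?_
    (fun t ht => single_mem_problemActions hm he _ ht) (Set.Icc_infinite (by positivity))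
  intro t _ t' _ h
  simpa using congrArg (fun v : EuclideanSpace ℝ (Fin d) => v ⟨0, hd⟩) h

/-- Admitted action sets of size `K` that contain all the vertices and span. For a single problem
with one option per coordinate the vertices are the standard basis; otherwise multiples of the basis
vectors are added. -/
theorem exists_problem_actionSet {K : ℕ} (hd : 0 < d) (hm : 0 < m) (he : Function.Injective e)
    (hK : (m = 1 ∧ d ≤ K) ∨ n ^ m + d ≤ K) :
    ∃ A : Finset (EuclideanSpace ℝ (Fin d)), A.card = K ∧ (∀ a ∈ A, a ∈ problemActions e) ∧
      Submodule.span ℝ (A : Set (EuclideanSpace ℝ (Fin d))) = ⊤ ∧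
      ∀ s, problemVertex e s ∈ A := by
  classical
  have hone : 0 < 1 / √(m : ℝ) := by positivity
  set E : Finset (EuclideanSpace ℝ (Fin d)) :=
    Finset.univ.image fun l => EuclideanSpace.single l (1 / √(m : ℝ))
  have hEcard : E.card ≤ d := Finset.card_image_le.trans_eq (by simp)
  have hEmem : ∀ l, EuclideanSpace.single l (1 / √(m : ℝ)) ∈ E := fun l =>
    Finset.mem_image_of_mem _ (Finset.mem_univ l)
  set V : Finset (EuclideanSpace ℝ (Fin d)) := Finset.univ.image (problemVertex e)
  have hVcard : V.card ≤ n ^ m := Finset.card_image_le.trans_eq (by simp)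
  have hVmem : ∀ s, problemVertex e s ∈ V := fun s =>
    Finset.mem_image_of_mem _ (Finset.mem_univ s)
  have hVE : (V ∪ E).card ≤ K := by
    rcases hK with ⟨rfl, hdK⟩ | hK
    · have hsub : V ⊆ E := by
        intro a ha
        obtain ⟨s, -, rfl⟩ := Finset.mem_image.mp ha
        refine Finset.mem_image.mpr ⟨e (0, s 0), Finset.mem_univ _, ?_⟩
        ext j
        simp only [problemVertex, coordVec_apply, Finset.univ_unique, Finset.sum_singleton]
        simp
      rw [Finset.union_eq_right.mpr hsub]
      exact hEcard.trans hdK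
    · exact (Finset.card_union_le _ _).trans (by omega)
  obtain ⟨A, hVA, hAC, hA⟩ :=
    (infinite_problemActions hd hm he).exists_finset_superset_card_eq (S := V ∪ E) (fun a ha => by
      rcases Finset.mem_union.mp ha with ha | ha
      · obtain ⟨s, -, rfl⟩ := Finset.mem_image.mp ha
        exact problemVertex_mem hm he s
      · obtain ⟨l, -, rfl⟩ := Finset.mem_image.mp ha
        exact single_mem_problemActions hm he l ⟨hone.le, le_rfl⟩) hVE
  exact ⟨A, hA, hAC,
    span_eq_top_of_single_mem hone.ne' fun l => hVA (Finset.mem_union_right _ (hEmem l)),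
    fun s => hVA (Finset.mem_union_left _ (hVmem s))⟩

end problemActions

/-- The number of problems: of the order of `min d (log K)` up to a factor `log d`, with at least
two coordinates per problem and few enough vertices. -/
theorem exists_number_of_problems {d K : ℕ} (hd : 2 ≤ d) (hdK : d ≤ K) :
    ∃ m : ℕ, 0 < m ∧ 2 * m ≤ d ∧ ((m = 1 ∧ d ≤ K) ∨ (d / m) ^ m + d ≤ K) ∧
      min (d : ℝ) (Real.log K) ≤ 3 * (m * (1 + Real.log d)) := by
  have hlogd : 0 ≤ Real.log d := Real.log_natCast_nonneg d
  have hL : 1 ≤ Nat.log d K := Nat.log_pos (by omega) hdK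
  have hlogK := log_natCast_le_mul_log d (by omega) (by omega : 0 < K)
  by_cases hsmall : d / 2 ≤ 1 ∨ Nat.log d K ≤ 2
  · refine ⟨1, one_pos, by omega, Or.inl ⟨rfl, hdK⟩, ?_⟩
    rw [Nat.cast_one, one_mul]
    rcases hsmall with h | h
    · have : (d : ℝ) ≤ 3 := by exact_mod_cast (by omega : d ≤ 3)
      exact (min_le_left _ _).trans (by linarith)
    · have : (Nat.log d K : ℝ) ≤ 2 := by exact_mod_cast h
      exact (min_le_right _ _).trans (by nlinarith)
  push Not at hsmall
  refine ⟨min (d / 2) (Nat.log d K - 1), by omega, by omega, Or.inr ?_, ?_⟩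
  · have h1 : (d / min (d / 2) (Nat.log d K - 1)) ^ min (d / 2) (Nat.log d K - 1) ≤
        d ^ (Nat.log d K - 1) :=
      (Nat.pow_le_pow_left (Nat.div_le_self _ _) _).trans
        (Nat.pow_le_pow_right (by omega) (min_le_right _ _))
    have h2 : d ^ 1 ≤ d ^ (Nat.log d K - 1) := Nat.pow_le_pow_right (by omega) (by omega)
    have h3 : d * d ^ (Nat.log d K - 1) ≤ K := by
      rw [← pow_succ', Nat.sub_add_cancel hL]
      exact Nat.pow_log_le_self d (by omega)
    have h4 : 2 * d ^ (Nat.log d K - 1) ≤ d * d ^ (Nat.log d K - 1) := Nat.mul_le_mul_right _ hd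
    rw [pow_one] at h2
    omega
  · rcases min_choice (d / 2) (Nat.log d K - 1) with hm | hm <;> rw [hm]
    · have h1 : (d : ℝ) ≤ 3 * (d / 2 : ℕ) := by exact_mod_cast (by omega : d ≤ 3 * (d / 2))
      have h2 : (0 : ℝ) ≤ (d / 2 : ℕ) := Nat.cast_nonneg _
      exact (min_le_left _ _).trans (by nlinarith)
    · have h1 : (3 : ℝ) ≤ Nat.log d K := by exact_mod_cast hsmall.2
      rw [Nat.cast_sub hL, Nat.cast_one]
      refine (min_le_right _ _).trans (hlogK.trans ?_)
      nlinarith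

namespace OneBitAlgorithm

/-- An action set on which the noise forces regret of the order of `√(d T min d (log K))`, up to a
factor of the order of `√(1 + log d)`. -/
theorem exists_noise_actionSet {d K B T : ℕ} (hd : 1 ≤ d) (hdK : d ≤ K) (hK : 2 ≤ K)
    (hT : 1 ≤ T) (hB : 0 < B) {σ : ℝ} (hσ : 0 < σ) :
    ∃ A : Finset (EuclideanSpace ℝ (Fin d)), A.card = K ∧ (∀ a ∈ A, ‖a‖ ≤ 1) ∧
      Submodule.span ℝ (A : Set (EuclideanSpace ℝ (Fin d))) = ⊤ ∧
      ∀ (Ω : Type*) [MeasurableSpace Ω] (P : Measure Ω) [IsProbabilityMeasure P]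
        (alg : OneBitAlgorithm A B Ω),
        min (T : ℝ) (σ / 8 * (√(d * T * min (d : ℝ) (Real.log K)) / (1 + Real.log d))) / 4 ≤
          alg.worstCaseRegret hB T P σ := by
  classical
  have hTpos : (1 : ℝ) ≤ T := by exact_mod_cast hT
  have hlogd : 0 ≤ Real.log d := Real.log_natCast_nonneg d
  rcases hd.eq_or_lt with rfl | hd2
  · -- In dimension one the two options are the endpoints of the interval `[-1, 1]`.
    set e₁ : EuclideanSpace ℝ (Fin 1) := EuclideanSpace.single 0 1 with he₁
    have hnorm : ‖e₁‖ = 1 := by simp [he₁]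
    obtain ⟨A, hSA, hAball, hA⟩ := (infinite_closedBall le_rfl).exists_finset_superset_card_eq
      (S := {e₁, -e₁}) (fun a ha => by
        rcases Finset.mem_insert.mp ha with rfl | ha
        · simp [hnorm]
        · rw [Finset.mem_singleton.mp ha]; simp [hnorm])
      (K := K) ((Finset.card_le_two).trans hK)
    have hAnorm : ∀ a ∈ A, ‖a‖ ≤ 1 := fun a ha => mem_closedBall_zero_iff.mp (hAball a ha)
    have hmem : e₁ ∈ A := hSA (by simp)
    have hmem' : -e₁ ∈ A := hSA (by simp)
    refine ⟨A, hA, hAnorm, span_eq_top_of_single_mem one_ne_zero fun l => by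
      rwa [Subsingleton.elim l 0], fun Ω _ P _ alg => ?_⟩
    set Δ : ℝ := min 1 (σ / (2 * √T)) with hΔ
    have hΔ0 : 0 ≤ Δ := le_min zero_le_one (by positivity)
    have hΔ1 : Δ ≤ 1 := min_le_left _ _
    set ε : Fin 2 → ℝ := ![1, -1] with hε
    have hεabs : ∀ i, |ε i| = 1 := fun i => by fin_cases i <;> simp [hε]
    have hcoord : ∀ a ∈ A, |a 0| ≤ 1 := fun a ha => by
      have := sum_sq_apply_le (Function.injective_id (α := Fin 1)) (hAnorm a ha)
      simpa using this
    have hinner : ∀ (i : Fin 2) (a : EuclideanSpace ℝ (Fin 1)),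
        inner ℝ a ((Δ / 2 * ε i) • e₁) = Δ * ((1 + ε i * a 0) / 2) + -(Δ / 2) := fun i a => by
      rw [inner_smul_right, he₁, EuclideanSpace.inner_single_right]
      simp
      ring
    have hmain := alg.mul_le_worstCaseRegret_of_problems hB T P hσ hAnorm (m := 1) (n := 2) le_rfl
      (w := fun _ i a => (1 + ε i * a 0) / 2) (θ := fun s => (Δ / 2 * ε (s 0)) • e₁)
      (Δ := Δ) (c := -(Δ / 2))
      (fun _ i a ha => by
        have := neg_abs_le (ε i * a 0)
        rw [abs_mul, hεabs, one_mul] at this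
        have := hcoord a ha
        linarith)
      (fun _ a _ => by simp [hε, Fin.sum_univ_two]; linarith)
      (fun s => by
        rw [norm_smul, hnorm, mul_one, Real.norm_eq_abs, abs_mul, hεabs, mul_one,
          abs_of_nonneg (by linarith)]
        linarith)
      hΔ0
      (by
        have h1 : Δ ^ 2 ≤ (σ / (2 * √T)) ^ 2 := pow_le_pow_left₀ hΔ0 (min_le_right _ _) 2
        have h2 : (σ / (2 * √T)) ^ 2 * T = σ ^ 2 / 4 := by
          rw [div_pow, mul_pow, Real.sq_sqrt (by linarith)]
          field_simp
          norm_num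
        have h3 : Δ ^ 2 * T ≤ σ ^ 2 / 4 := h2 ▸ mul_le_mul_of_nonneg_right h1 (by linarith)
        rw [Nat.cast_ofNat]
        linarith)
      (fun s a _ => by simpa using hinner (s 0) a)
      (fun s => by
        have hval : ∀ i, inner ℝ (ε i • e₁) ((Δ / 2 * ε i) • e₁) = Δ * (1 : ℕ) + -(Δ / 2) :=
          fun i => by
            rw [hinner]
            fin_cases i <;> simp [hε, he₁]
        refine ⟨ε (s 0) • e₁, ?_, hval (s 0)⟩
        generalize s 0 = i
        fin_cases i
        · simpa [hε] using hmem
        · simpa [hε] using hmem')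
    refine le_trans ?_ hmain
    have hTsqrt : T * (σ / (2 * √T)) = σ / 2 * √T := by
      nth_rewrite 1 [← Real.mul_self_sqrt (by linarith : (0 : ℝ) ≤ T)]
      field_simp
    have hsq : √((1 : ℕ) * T * min ((1 : ℕ) : ℝ) (Real.log K)) ≤ √T := by
      refine Real.sqrt_le_sqrt ?_
      rw [Nat.cast_one, one_mul]
      exact mul_le_of_le_one_right (by linarith) (min_le_left _ _)
    have hTΔ : T * ((1 : ℕ) * Δ) = min (T : ℝ) (σ / 2 * √T) := by
      rw [Nat.cast_one, one_mul, hΔ, mul_min_of_nonneg _ _ (by linarith), mul_one, hTsqrt]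
    rw [hTΔ]
    refine div_le_div_of_nonneg_right (min_le_min le_rfl ?_) (by norm_num)
    simp only [Nat.cast_one, Real.log_one, add_zero, div_one] at hsq ⊢
    exact mul_le_mul (by linarith) hsq (Real.sqrt_nonneg _) (by positivity)
  · obtain ⟨m, hm, hmd, hmK, hmin⟩ := exists_number_of_problems hd2 hdK
    have hn : 2 ≤ d / m := (Nat.le_div_iff_mul_le hm).mpr hmd
    set n := d / m with hn_def
    set e : Fin m × Fin n → Fin d :=
      fun x => Fin.castLE (Nat.mul_div_le d m) (finProdFinEquiv x)
    have he : Function.Injective e :=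
      (Fin.castLE_injective _).comp finProdFinEquiv.injective
    obtain ⟨A, hA, hAC, hspan, hvertex⟩ := exists_problem_actionSet (by omega) hm he hmK
    have hAnorm : ∀ a ∈ A, ‖a‖ ≤ 1 := fun a ha => (hAC a ha).1
    refine ⟨A, hA, hAnorm, hspan, fun Ω _ P _ alg => ?_⟩
    have hmpos : (0 : ℝ) < m := by exact_mod_cast hm
    set Δ : ℝ := min (1 / m) (σ * √(n / (8 * T))) with hΔ
    have hΔ0 : 0 ≤ Δ := le_min (by positivity) (by positivity)
    have hmΔ : Δ * m ≤ 1 := (le_div_iff₀ hmpos).mp (min_le_left _ _)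
    have hinner : ∀ s a, inner ℝ a ((Δ * m) • problemVertex e s) =
        Δ * ∑ b, √m * a (e (b, s b)) := fun s a => by
      rw [inner_smul_right, mul_assoc, inner_problemVertex]
    have hmain := alg.mul_le_worstCaseRegret_of_problems hB T P hσ hAnorm hn
      (w := fun b i a => √m * a (e (b, i))) (θ := fun s => (Δ * m) • problemVertex e s)
      (Δ := Δ) (c := 0)
      (fun b i a ha => mul_nonneg (Real.sqrt_nonneg _) ((hAC a ha).2.1 _))
      (fun b a ha => (hAC a ha).2.2 b)
      (fun s => by
        rw [norm_smul, norm_problemVertex hm he, mul_one,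
          Real.norm_of_nonneg (mul_nonneg hΔ0 hmpos.le)]
        exact hmΔ)
      hΔ0
      (by
        have h1 : Δ ^ 2 ≤ (σ * √(n / (8 * T))) ^ 2 := pow_le_pow_left₀ hΔ0 (min_le_right _ _) 2
        have h2 : 8 * ((σ * √(n / (8 * T))) ^ 2 * T) = σ ^ 2 * n := by
          rw [mul_pow, Real.sq_sqrt (by positivity)]
          field_simp
        rw [← h2]
        gcongr)
      (fun s a _ => by rw [hinner, add_zero])
      (fun s => ⟨problemVertex e s, hvertex s, by
        rw [inner_smul_right, real_inner_self_eq_norm_sq, norm_problemVertex hm he]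
        ring⟩)
    refine le_trans ?_ hmain
    have hdm : (d : ℝ) ≤ 2 * (m * n) := by
      have h1 : d < m * n + m := by
        have h3 := Nat.div_add_mod d m
        have h4 := Nat.mod_lt d hm
        rw [← hn_def] at h3
        omega
      have h2 : m ≤ m * n := Nat.le_mul_of_pos_right m (by omega)
      exact_mod_cast (by omega : d ≤ 2 * (m * n))
    have hsqrt : √(d * T * min (d : ℝ) (Real.log K)) / (1 + Real.log d) / 8 ≤
        T * (m * √(n / (8 * T))) := by
      have hl : 0 < 1 + Real.log d := by linarith
      rw [div_div, div_le_iff₀ (by positivity)]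
      refine Real.sqrt_le_iff.mpr ⟨by positivity, ?_⟩
      have h1 : (T * (m * √(n / (8 * T))) * ((1 + Real.log d) * 8)) ^ 2 =
          8 * T * (m * n) * m * (1 + Real.log d) ^ 2 := by
        rw [mul_pow, mul_pow, mul_pow, Real.sq_sqrt (by positivity)]
        field_simp
      rw [h1]
      calc (d : ℝ) * T * min (d : ℝ) (Real.log K)
          ≤ (2 * (m * n)) * T * (3 * (m * (1 + Real.log d))) := by gcongr
        _ = (6 * T * (m * n) * m * (1 + Real.log d)) * 1 := by ring
        _ ≤ (8 * T * (m * n) * m * (1 + Real.log d)) * (1 + Real.log d) := by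
          gcongr
          · norm_num
          · linarith
        _ = _ := by ring
    have hTm : T * (m * Δ) = min (T : ℝ) (σ * (T * (m * √(n / (8 * T))))) := by
      rw [hΔ, mul_min_of_nonneg _ _ hmpos.le, mul_one_div_cancel hmpos.ne',
        mul_min_of_nonneg _ _ (by linarith), mul_one]
      congr 1
      ring
    rw [hTm]
    refine div_le_div_of_nonneg_right (min_le_min le_rfl ?_) (by norm_num)
    rw [div_mul_eq_mul_div, mul_div_assoc]
    exact mul_le_mul_of_nonneg_left hsqrt hσ.le

end OneBitAlgorithm

/-! ### The regret bounds -/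

/-- Replacing `u` by any `m ≥ r u`, with `r ≤ 1`, costs at most the factor `r` in the bound. -/
theorem mul_min_le_min_of_mul_le {r u m : ℝ} (hr0 : 0 ≤ r) (hr1 : r ≤ 1) (hrm : r * u ≤ m)
    {d T B L : ℝ} (hd : 0 ≤ d) (hT : 0 ≤ T) (hB : 0 ≤ B) (hL : 0 ≤ L) (hu : 0 ≤ u) :
    r * min T (B * u + √(d * T * u) / L) ≤ min T (B * m + √(d * T * m) / L) := by
  have hsqrt : r * √(d * T * u) ≤ √(d * T * m) := by
    refine Real.le_sqrt_of_sq_le ?_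
    rw [mul_pow, Real.sq_sqrt (by positivity)]
    have h1 : r ^ 2 * (d * T * u) ≤ r * (d * T * u) :=
      mul_le_mul_of_nonneg_right (pow_le_of_le_one hr0 hr1 two_ne_zero) (by positivity)
    have h2 := mul_le_mul_of_nonneg_left hrm (mul_nonneg hd hT)
    linarith
  rw [mul_min_of_nonneg _ _ hr0]
  refine min_le_min (mul_le_of_le_one_left hT hr1) ?_
  rw [mul_add, ← mul_assoc, mul_comm r B, mul_assoc, mul_div_assoc']
  gcongr

namespace OneBitAlgorithm

/-- The bound in terms of `min d (log K)`. The action set depends on which of the two terms of the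
bound dominates. -/
theorem exists_actionSet {σ₀ : ℝ} (hσ₀ : 0 < σ₀) {d T B K : ℕ} (hd : 1 ≤ d) (hT : 1 ≤ T)
    (hB : 0 < B) (hdK : d ≤ K) {σ : ℝ} (hσ : σ₀ ≤ σ) :
    ∃ A : Finset (EuclideanSpace ℝ (Fin d)), A.card = K ∧ (∀ a ∈ A, ‖a‖ ≤ 1) ∧
      Submodule.span ℝ (A : Set (EuclideanSpace ℝ (Fin d))) = ⊤ ∧
      ∀ (Ω : Type*) [MeasurableSpace Ω] (P : Measure Ω) [IsProbabilityMeasure P]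
        (alg : OneBitAlgorithm A B Ω),
        min 1 σ₀ / 384 * min (T : ℝ) (B * min (d : ℝ) (Real.log K) +
          √(d * T * min (d : ℝ) (Real.log K)) / (1 + Real.log d)) ≤
          alg.worstCaseRegret hB T P σ := by
  have hTpos : (0 : ℝ) ≤ T := Nat.cast_nonneg T
  have hBpos : (0 : ℝ) ≤ B := Nat.cast_nonneg B
  have hlogd : 0 ≤ Real.log d := Real.log_natCast_nonneg d
  have hr0 : 0 < min 1 σ₀ := lt_min one_pos hσ₀
  rcases (hd.trans hdK).eq_or_lt with rfl | hK
  · -- With a single action the bound is zero.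
    obtain rfl : d = 1 := le_antisymm hdK hd
    obtain ⟨A, hSA, hAball, hA⟩ := (infinite_closedBall le_rfl).exists_finset_superset_card_eq
      (S := {EuclideanSpace.single (0 : Fin 1) (1 : ℝ)}) (K := 1) (by simp) (by simp)
    have hAnorm : ∀ a ∈ A, ‖a‖ ≤ 1 := fun a ha => mem_closedBall_zero_iff.mp (hAball a ha)
    refine ⟨A, hA, hAnorm, span_eq_top_of_single_mem one_ne_zero fun l => hSA (by
      simp [Subsingleton.elim l 0]), fun Ω _ P _ alg => ?_⟩
    refine le_of_eq_of_le ?_ (alg.worstCaseRegret_nonneg hB T P σ hAnorm)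
    simp
  set M := min (d : ℝ) (Real.log K) with hM
  have hM0 : 0 ≤ M := le_min (Nat.cast_nonneg d) (Real.log_natCast_nonneg K)
  set Y := √(d * T * M) / (1 + Real.log d) with hY
  have hY0 : 0 ≤ Y := by positivity
  rcases le_total Y (B * M) with hXY | hXY
  · obtain ⟨A, J, hA, hAnorm, hspan, hJ, ι, _, _, θ, hθ, hθA, hcount⟩ :=
      exists_spread_actionSet hd hdK hK
    refine ⟨A, hA, hAnorm, hspan, fun Ω _ P _ alg => ?_⟩
    refine le_trans ?_ (alg.min_le_worstCaseRegret_of_spread hB T P σ hAnorm hθ hθA hcount)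
    have h1 : B * M + Y ≤ 48 * (B * J) := by
      have := mul_le_mul_of_nonneg_left hJ hBpos
      linarith
    have h2 : min (T : ℝ) (B * M + Y) ≤ 48 * min (T : ℝ) (B * J) := by
      rw [mul_min_of_nonneg (T : ℝ) _ (by norm_num)]
      exact min_le_min (by linarith) h1
    have h3 : 0 ≤ min (T : ℝ) (B * M + Y) := le_min hTpos (by positivity)
    have h4 : min 1 σ₀ * min (T : ℝ) (B * M + Y) ≤ min (T : ℝ) (B * M + Y) :=
      mul_le_of_le_one_left h3 (min_le_left _ _)
    linarith
  · obtain ⟨A, hA, hAnorm, hspan, hreg⟩ :=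
      exists_noise_actionSet hd hdK hK hT hB (hσ₀.trans_le hσ)
    refine ⟨A, hA, hAnorm, hspan, fun Ω _ P _ alg => ?_⟩
    refine le_trans ?_ (hreg Ω P alg)
    have h1 : min 1 σ₀ / 16 * min (T : ℝ) (B * M + Y) ≤ min (T : ℝ) (σ / 8 * Y) := by
      rw [mul_min_of_nonneg (T : ℝ) _ (by positivity)]
      refine min_le_min (mul_le_of_le_one_left hTpos ?_) ?_
      · linarith [min_le_left 1 σ₀]
      · calc min 1 σ₀ / 16 * (B * M + Y) ≤ σ / 16 * (2 * Y) := by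
              refine mul_le_mul ?_ (by linarith) (by positivity) (by linarith)
              linarith [min_le_right 1 σ₀]
          _ = σ / 8 * Y := by ring
    have h3 : 0 ≤ min 1 σ₀ * min (T : ℝ) (B * M + Y) :=
      mul_nonneg hr0.le (le_min hTpos (by positivity))
    linarith

end OneBitAlgorithm

theorem corollary2 :
    ∃ p : ℕ, ∀ σ₀ σ₁ : ℝ, 0 < σ₀ → σ₀ ≤ σ₁ →
      ∃ (c : ℝ) (c₁ c₂ : ℝ → ℝ), 0 < c ∧ (∀ α > 0, 0 < c₁ α) ∧ (∀ β > 0, 0 < c₂ β) ∧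
        ∀ (d T B K : ℕ) (_hd : 1 ≤ d) (_hT : 1 ≤ T) (hB : 0 < B) (_hK : d ≤ K) (σ : ℝ),
          σ₀ ≤ σ → σ ≤ σ₁ →
          ∃ A : Finset (EuclideanSpace ℝ (Fin d)),
            A.card = K ∧ (∀ a ∈ A, ‖a‖ ≤ 1) ∧
            Submodule.span ℝ (A : Set (EuclideanSpace ℝ (Fin d))) = ⊤ ∧
            ∀ (Ω : Type*) [MeasurableSpace Ω] (P : Measure Ω) [IsProbabilityMeasure P]
              (alg : OneBitAlgorithm A B Ω),
              c * min (T : ℝ)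
                  (B * min (d : ℝ) (Real.log K) +
                    √(d * T * min (d : ℝ) (Real.log K)) / (1 + Real.log d) ^ p)
                ≤ alg.worstCaseRegret hB T P σ ∧
              (∀ α > 0, Real.exp (α * d) ≤ K →
                c₁ α * min (T : ℝ) (d * B + d * √(T : ℝ) / (1 + Real.log d) ^ p)
                  ≤ alg.worstCaseRegret hB T P σ) ∧
              (∀ β > 0, (K : ℝ) ≤ Real.exp (β * d) →
                c₂ β * min (T : ℝ)
                    (B * Real.log K + √(d * T * Real.log K) / (1 + Real.log d) ^ p)
                  ≤ alg.worstCaseRegret hB T P σ) := by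

  refine ⟨1, fun σ₀ σ₁ hσ₀ _ => ⟨min 1 σ₀ / 384, fun α => min 1 σ₀ / 384 * min 1 α,
    fun β => min 1 σ₀ / 384 * (max 1 β)⁻¹, ?_, fun α hα => ?_, fun β _ => ?_, ?_⟩⟩
  · have := lt_min one_pos hσ₀
    positivity
  · have := lt_min one_pos hσ₀
    have := lt_min one_pos hα
    positivity
  · have := lt_min one_pos hσ₀
    positivity
  intro d T B K hd hT hB hdK σ hσ _
  obtain ⟨A, hA, hAnorm, hspan, hreg⟩ := OneBitAlgorithm.exists_actionSet hσ₀ hd hT hB hdK hσ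
  refine ⟨A, hA, hAnorm, hspan, fun Ω _ P _ alg => ?_⟩
  have hmain := hreg Ω P alg
  have hc : 0 ≤ min 1 σ₀ / 384 := by
    have := lt_min one_pos hσ₀
    positivity
  have hd0 : (0 : ℝ) ≤ d := Nat.cast_nonneg d
  have hlogd : 0 ≤ Real.log d := Real.log_natCast_nonneg d
  have hlogK : 0 ≤ Real.log K := Real.log_natCast_nonneg K
  have hK : (0 : ℝ) < K := by exact_mod_cast (by omega : 0 < K)
  have hL : 0 ≤ 1 + Real.log d := by linarith
  simp only [pow_one]
  refine ⟨hmain, fun α hα hexp => ?_, fun β hβ hexp => ?_⟩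
  · have hα0 : 0 < min 1 α := lt_min one_pos hα
    have hle : min 1 α * d ≤ min (d : ℝ) (Real.log K) := by
      refine le_min (mul_le_of_le_one_left hd0 (min_le_left _ _)) ?_
      exact (mul_le_mul_of_nonneg_right (min_le_right _ _) hd0).trans
        ((Real.le_log_iff_exp_le hK).mpr hexp)
    have hsqrt : (d : ℝ) * √T = √(d * T * d) := by
      rw [mul_right_comm, Real.sqrt_mul (mul_self_nonneg _), Real.sqrt_mul_self hd0]
    refine le_trans ?_ hmain
    rw [mul_assoc, hsqrt, mul_comm (d : ℝ) B]
    exact mul_le_mul_of_nonneg_left (mul_min_le_min_of_mul_le hα0.le (min_le_left _ _) hle hd0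
      (Nat.cast_nonneg T) (Nat.cast_nonneg B) hL hd0) hc
  · have hβ1 : 1 ≤ max 1 β := le_max_left _ _
    have hle : (max 1 β)⁻¹ * Real.log K ≤ min (d : ℝ) (Real.log K) := by
      rw [inv_mul_le_iff₀ (by positivity), mul_min_of_nonneg _ _ (by positivity)]
      refine le_min (((Real.log_le_iff_le_exp hK).mpr hexp).trans ?_)
        (le_mul_of_one_le_left hlogK hβ1)
      exact mul_le_mul_of_nonneg_right (le_max_right _ _) hd0
    refine le_trans ?_ hmain
    rw [mul_assoc]
    exact mul_le_mul_of_nonneg_left (mul_min_le_min_of_mul_le (by positivity)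
      (inv_le_one_of_one_le₀ hβ1) hle hd0 (Nat.cast_nonneg T) (Nat.cast_nonneg B) hL hlogK) hc
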